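/- For a finite simple graph $G$ with vertex set $\{1,\dots,N\}$, order the edges $\{a<b\}$ lexicographically. An enhanced state of $G$ is a pair $S=(s,c)$, where $s\subseteq E(G)$ and $c$ assigns to each connected component of the spanning graph $[G:s]=(V(G),s)$ one of the colours $1,x\in\mathbb{Z}[x]/(x^2)$. Let $C^{i,j}(G)$ be the free $\mathbb{Z}$-module on the enhanced states with $\#s=i$ and exactly $j$ components coloured $x$, and let $\partial^{i,j}\colon C^{i,j}(G)\to C^{i+1,j}(G)$ be given by $$\partial^{i,j}(S)=\sum_{e\in E(G)\setminus s}(-1)^{n(e)}S_e ,$$ where $n(e)$ is the number of edges of $s$ smaller than $e$ and $S_e=(s\cup\{e\},c_e)$: if $e$ joins two different components of $[G:s]$, the new component gets the product in $\mathbb{Z}[x]/(x^2)$ of their two colours (and $S_e=0$ if this product is $0$), and all other colours are unchanged. The chromatic homology $H^i(G)$ ($i\ge 0$) is the graded $\mathbb{Z}$-module $\bigoplus_j H^{i,j}(G)$ with $H^{i,j}(G)=\ker\partial^{i,j}/\operatorname{im}\partial^{i-1,j}$, where $C^{-1,j}(G)=0$. For a graded $\mathbb{Z}$-module $M$ let $M\{l\}_j=M_{j-l}$,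 and let $\mathbb{Z}$ be concentrated in degree $0$. Theorem. For $n\ge 4$ the chromatic homology of the complete graph $K_n$ on $n$ vertices is given recursively, up to isomorphism of graded $\mathbb{Z}$-modules, by $$H^i(K_n)\cong\begin{cases}\mathbb{Z}\{n\} & i=0,\\ H^{i-1}(K_{n-1})^{\oplus(n-2)}\oplus H^i(K_{n-1})\{1\} & 1\le i\le n-2,\\ 0 & i\ge n-1.\end{cases}$$ -/

import Mathlib

noncomputable section

namespace ChromaticHomology

/-! ### Graded abelian groups -/

/-- A graded `ℤ`-module `M = ⨁ j, M j`, given by its homogeneous components. -/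
abbrev GrMod : Type 1 := ℤ → ModuleCat.{0} ℤ

namespace GrMod

/-- The shift `M{l}`, with `M{l}_j = M_{j-l}`. -/
def shift (M : GrMod) (l : ℤ) : GrMod := fun j => M (j - l)

/-- The direct sum of two graded modules. -/
def sum (M N : GrMod) : GrMod := fun j => ModuleCat.of ℤ (M j × N j)

/-- The direct sum `M^{⊕ k}` of `k` copies of a graded module. -/
def power (M : GrMod) (k : ℕ) : GrMod := fun j => ModuleCat.of ℤ (Fin k → M j)

/-- The graded module `ℤ`, concentrated in degree `0`. -/
def int : GrMod := fun j =>
  ModuleCat.of ℤ ((if j = 0 then ⊤ else ⊥ : Submodule ℤ ℤ) : Submodule ℤ ℤ)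

/-- The zero graded module. -/
def zero : GrMod := fun _ => ModuleCat.of ℤ PUnit.{1}

/-- Two graded modules are isomorphic: there is a degree-preserving linear isomorphism. -/
def Isomorphic (M N : GrMod) : Prop := Nonempty (∀ j : ℤ, M j ≃ₗ[ℤ] N j)

end GrMod

/-! ### Enhanced states -/

variable {V : Type} [LinearOrder V]

/-- The lexicographic order on edges: `{i₁, i₂} < {j₁, j₂}` (with `i₁ ≤ i₂`, `j₁ ≤ j₂`) when
`(i₁, i₂) < (j₁, j₂)` lexicographically. -/
def EdgeLT (e f : Sym2 V) : Prop := toLex (e.inf, e.sup) < toLex (f.inf, f.sup)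

/-- The spanning graph `[G : s] = (V(G), s)`. -/
abbrev spanning (s : Finset (Sym2 V)) : SimpleGraph V :=
  SimpleGraph.fromEdgeSet (s : Set (Sym2 V))

/-- An enhanced state `S = (s, c)` of `G`: a set `s` of edges of `G` and a colouring `c` of the
connected components of `[G : s]` by `1` and `x`. The colouring is recorded by the set `xs` of the
components coloured `x`; all other components are coloured `1`. -/
@[ext]
structure EnhancedState (G : SimpleGraph V) where
  /-- the edges of the state -/
  s : Finset (Sym2 V)
  /-- they are edges of `G` -/
  s_subset : (s : Set (Sym2 V)) ⊆ G.edgeSet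
  /-- the components coloured `x` -/
  xs : Finset (spanning s).ConnectedComponent

namespace EnhancedState

variable {G : SimpleGraph V}

/-- Enhanced states `S` with `i(S) = #s = i` and `j(S) = #{components coloured x} = j`. -/
abbrev OfBidegree (G : SimpleGraph V) (i : ℕ) (j : ℤ) : Type :=
  {S : EnhancedState G // S.s.card = i ∧ (S.xs.card : ℤ) = j}

theorem spanning_le_insert (s : Finset (Sym2 V)) (e : Sym2 V) :
    spanning s ≤ spanning (insert e s) :=
  SimpleGraph.fromEdgeSet_mono (by simp)

/-- The map sending a component of `[G : s]` to the component of `[G : s ∪ {e}]` containing it. -/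
def compMap (s : Finset (Sym2 V)) (e : Sym2 V) :
    (spanning s).ConnectedComponent → (spanning (insert e s)).ConnectedComponent :=
  SimpleGraph.ConnectedComponent.map (SimpleGraph.Hom.ofLE (spanning_le_insert s e))

/-- The number `n(e)` of edges of `s` that are ordered before `e`. -/
def numBefore (s : Finset (Sym2 V)) (e : Sym2 V) : ℕ :=
  {f : Sym2 V | f ∈ s ∧ EdgeLT f e}.ncard

/-- `S_e` is nonzero. The colour `c_e(D)` of a component `D` of `[G : s ∪ {e}]` is the product in
`ℤ[x]/(x²)` of the colours of the components of `[G : s]` contained in `D` (two components if `e`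
joins them to form `D`, one component otherwise). It is `1`, `x` or `0` when
none, one or two of these are coloured `x`; so `S_e ≠ 0` iff distinct `x`-coloured components stay
distinct. -/
def Survives (S : EnhancedState G) (e : Sym2 V) : Prop :=
  Set.InjOn (compMap S.s e) (S.xs : Set (spanning S.s).ConnectedComponent)

open Classical in
/-- The enhanced state `S_e = (s ∪ {e}, c_e)` (meaningful when `S.Survives e`): a component is
coloured `x` when it contains an `x`-coloured component of `[G : s]`. -/
def addEdge (S : EnhancedState G) (e : Sym2 V) (he : e ∈ G.edgeSet) : EnhancedState G where
  s := insert e S.s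
  s_subset := by
    rw [Finset.coe_insert]
    exact Set.insert_subset he S.s_subset
  xs := S.xs.image (compMap S.s e)

/-- Adding an edge raises `i` by one and keeps `j`. -/
theorem addEdge_bidegree {i : ℕ} {j : ℤ} (S : OfBidegree G i j) (e : Sym2 V)
    (he : e ∈ G.edgeSet) (hs : e ∉ S.1.s) (hS : S.1.Survives e) :
    (S.1.addEdge e he).s.card = i + 1 ∧ ((S.1.addEdge e he).xs.card : ℤ) = j := by
  refine ⟨?_, ?_⟩
  · show (insert e S.1.s).card = i + 1
    rw [Finset.card_insert_of_notMem hs, S.2.1]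
  · classical
    refine Eq.trans (congrArg _ ?_) S.2.2
    exact Finset.card_image_of_injOn hS

end EnhancedState

open EnhancedState

variable [Fintype V]

/-! ### The chromatic complex and its homology -/

/-- `C^{i,j}(G)`: the free `ℤ`-module on the enhanced states `S` with `i(S) = i`, `j(S) = j`. -/
abbrev Chain (G : SimpleGraph V) (i : ℕ) (j : ℤ) : Type := OfBidegree G i j →₀ ℤ

open Classical in
/-- The differential on a generator: `∂ S = ∑_{e ∈ E(G) ∖ s} (-1)^{n(e)} S_e`. -/
def diffState {G : SimpleGraph V} {i : ℕ} {j : ℤ} (S : OfBidegree G i j) : Chain G (i + 1) j :=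
  ∑ e : Sym2 V,
    if h : e ∈ G.edgeSet ∧ e ∉ S.1.s ∧ S.1.Survives e then
      Finsupp.single ⟨S.1.addEdge e h.1, addEdge_bidegree S e h.1 h.2.1 h.2.2⟩
        ((-1 : ℤ) ^ numBefore S.1.s e)
    else 0

/-- The differential `∂^{i,j} : C^{i,j}(G) → C^{i+1,j}(G)`. -/
def diff (G : SimpleGraph V) (i : ℕ) (j : ℤ) : Chain G i j →ₗ[ℤ] Chain G (i + 1) j :=
  Finsupp.linearCombination ℤ diffState

/-- The coboundaries in `C^{i,j}(G)`, i.e. the image of `∂^{i-1,j}`, where `C^{-1,j}(G) = 0`. -/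
def boundaries (G : SimpleGraph V) : (i : ℕ) → (j : ℤ) → Submodule ℤ (Chain G i j)
  | 0, _ => ⊥
  | i + 1, j => LinearMap.range (diff G i j)

/-- The chromatic homology `H^i(G)`, a graded `ℤ`-module whose component of degree `j` is
`H^{i,j}(G) = ker ∂^{i,j} / im ∂^{i-1,j}` (`submoduleOf` views the image as a submodule of the
kernel). -/
def H (G : SimpleGraph V) (i : ℕ) : GrMod := fun j =>
  ModuleCat.of ℤ
    (LinearMap.ker (diff G i j) ⧸ (boundaries G i j).submoduleOf (LinearMap.ker (diff G i j)))

/-- The complete graph `K_n` on `n` vertices. -/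
abbrev K (n : ℕ) : SimpleGraph (Fin n) := ⊤

end ChromaticHomology

end

/-!
The cochain groups are quotients of polynomial modules: a colouring of the components of `[G : s]`
is a product of vertex variables, modulo `X v ^ 2` and modulo `X a - X b` for `{a, b} ∈ s`. In this
presentation adding an edge leaves the polynomial unchanged and only enlarges the ideal.

Split an edge set of `K_n` by its edges at the vertex `0`. The edge sets with at least two of them
contribute nothing: if `{0, a}` and `{0, b}` are present, adding or removing `{a, b}` does not
affect the components, and this contracts that part. On the edge sets with no edge at `0`, the part
linear in `X 0` is the complex of `K_{n-1}`, with degrees shifted by one. The edge sets whose only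
edge at `0` is `{0, k}` give `n - 1` copies of the complex of `K_{n-1}`, shifted by one in `i`; the
part with no edge at `0` and no `X 0` cancels one of them, and the differences of the copies give
the other `n - 2`.

The two parts interact by multiplication by `X a - X b`. An edge `{a, l}` makes multiplication by
`X a + X l` null-homotopic, because `X a` and `X l` agree and square to zero once the edge is
added. Hence multiplication by `X a - X b` is null-homotopic as soon as there is a third vertex `l`,
that is, for `n ≥ 4`. In degree zero, a cocycle `p` satisfies `2 * X a * p = 0` for each vertex `a`
of a triangle, which kills every coefficient except the one at the product of all variables.
-/

noncomputable section

namespace ChromaticHomology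

open MvPolynomial EnhancedState

/-! ### Complexes given by representatives -/

section Subquotient

variable {R M M' P : Type*} [Ring R] [AddCommGroup M] [Module R M] [AddCommGroup M'] [Module R M']
  [AddCommGroup P] [Module R P]

/-- The isomorphism `Z / (B ∩ Z) ≃ P` induced by a surjection `Z → P` with kernel `B ∩ Z`. -/
def subquotientEquiv (Z B : Submodule R M) (L : Z →ₗ[R] P) (hL : Function.Surjective L)
    (hB : ∀ z : Z, L z = 0 ↔ (z : M) ∈ B) : (Z ⧸ B.submoduleOf Z) ≃ₗ[R] P :=
  (Submodule.quotEquivOfEq _ _ (by ext z; exact (hB z).symm)).trans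
    (L.quotKerEquivOfSurjective hL)

/-- The isomorphism of subquotients induced by a linear map `φ` that maps `Z` into `Z'`. -/
def subquotientCongr (Z B : Submodule R M) (Z' B' : Submodule R M')
    (φ : M →ₗ[R] M') (hZ : ∀ z ∈ Z, φ z ∈ Z') (hB : ∀ z ∈ Z, φ z ∈ B' ↔ z ∈ B)
    (hsurj : ∀ z' ∈ Z', ∃ z ∈ Z, φ z - z' ∈ B') :
    (Z ⧸ B.submoduleOf Z) ≃ₗ[R] (Z' ⧸ B'.submoduleOf Z') :=
  subquotientEquiv Z B ((B'.submoduleOf Z').mkQ ∘ₗ φ.restrict hZ)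
    (by
      intro q
      obtain ⟨z', rfl⟩ := Submodule.mkQ_surjective _ q
      obtain ⟨z, hz, h⟩ := hsurj z' z'.2
      exact ⟨⟨z, hz⟩, (Submodule.Quotient.eq _).2 h⟩)
    (by
      intro z
      rw [← hB z z.2]
      exact Submodule.Quotient.mk_eq_zero _)

end Subquotient

/-- A cochain complex given by representatives: its term of degree `i` is `part i` modulo the
elements of `null`, the representatives of zero, and its differential is induced by `d`. -/
structure PresentedComplex (R M : Type*) [Ring R] [AddCommGroup M] [Module R M] where
  d : M →ₗ[R] M
  part : ℤ → Submodule R M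
  null : Submodule R M
  d_mem_part {i : ℤ} {x : M} : x ∈ part i → d x ∈ part (i + 1)
  d_mem_null {x : M} : x ∈ null → d x ∈ null
  d_d (x : M) : d (d x) = 0

namespace PresentedComplex

variable {R M : Type*} [Ring R] [AddCommGroup M] [Module R M] (C : PresentedComplex R M)

/-- The representatives of the cocycles of degree `i`. -/
def cocycles (i : ℤ) : Submodule R M := C.part i ⊓ C.null.comap C.d

/-- The representatives of the coboundaries of degree `i`. -/
def coboundaries (i : ℤ) : Submodule R M := (C.part (i - 1)).map C.d ⊔ C.null

/-- The cohomology of a complex given by representatives. -/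
abbrev Cohomology (i : ℤ) : Type _ :=
  C.cocycles i ⧸ (C.coboundaries i).submoduleOf (C.cocycles i)

variable {C} {i : ℤ} {x : M}

theorem mem_cocycles : x ∈ C.cocycles i ↔ x ∈ C.part i ∧ C.d x ∈ C.null := Iff.rfl

theorem mem_coboundaries :
    x ∈ C.coboundaries i ↔ ∃ y ∈ C.part (i - 1), x - C.d y ∈ C.null := by
  simp only [coboundaries, Submodule.mem_sup, Submodule.mem_map]
  constructor
  · rintro ⟨_, ⟨y, hy, rfl⟩, z, hz, rfl⟩
    exact ⟨y, hy, by simpa using hz⟩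
  · rintro ⟨y, hy, h⟩
    exact ⟨_, ⟨y, hy, rfl⟩, _, h, by simp⟩

theorem d_mem_cocycles (hx : x ∈ C.part i) : C.d x ∈ C.cocycles (i + 1) :=
  mem_cocycles.2 ⟨C.d_mem_part hx, by simp [C.d_d]⟩

theorem sub_d_mem_cocycles (hx : x ∈ C.cocycles i) {y : M} (hy : y ∈ C.part (i - 1)) :
    x - C.d y ∈ C.cocycles i := by
  refine ⟨(C.part i).sub_mem hx.1 (by simpa using C.d_mem_part hy), ?_⟩
  simpa [C.d_d] using hx.2

/-- A family of cochain maps `φ k` from `C` to the complexes `D k`, which lower degrees by `δ k` and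
commute with the differentials up to the sign `ε k`, that is jointly surjective with acyclic
joint kernel. -/
structure IsQuasiIsoFamily {M' κ : Type*} [AddCommGroup M'] [Module R M']
    (C : PresentedComplex R M) (D : κ → PresentedComplex R M') (δ : κ → ℤ) (ε : κ → ℤˣ)
    (φ : κ → M →ₗ[R] M') : Prop where
  map_mem_part {i : ℤ} {x : M} (k : κ) : x ∈ C.part i → φ k x ∈ (D k).part (i - δ k)
  map_mem_null {x : M} (k : κ) : x ∈ C.null → φ k x ∈ (D k).null
  map_d (k : κ) (x : M) : φ k (C.d x) - ε k • (D k).d (φ k x) ∈ (D k).null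
  exists_lift (i : ℤ) (y : κ → M') :
    (∀ k, y k ∈ (D k).part (i - δ k)) → ∃ x ∈ C.part i, ∀ k, φ k x = y k
  acyclic {i : ℤ} {x : M} : x ∈ C.cocycles i → (∀ k, φ k x ∈ (D k).null) →
    ∃ y ∈ C.part (i - 1), (∀ k, φ k y ∈ (D k).null) ∧ x - C.d y ∈ C.null

namespace IsQuasiIsoFamily

variable {M' κ : Type*} [AddCommGroup M'] [Module R M'] {D : κ → PresentedComplex R M'}
  {δ : κ → ℤ} {ε : κ → ℤˣ} {φ : κ → M →ₗ[R] M'}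

theorem map_d_mem_null_iff (hφ : IsQuasiIsoFamily C D δ ε φ) (k : κ) (x : M) :
    φ k (C.d x) ∈ (D k).null ↔ (D k).d (φ k x) ∈ (D k).null := by
  rw [← sub_add_cancel (φ k (C.d x)) (ε k • (D k).d (φ k x)),
    (D k).null.add_mem_iff_right (hφ.map_d k x)]
  rcases Int.units_eq_one_or (ε k) with h | h <;> simp [h]

theorem map_mem_cocycles (hφ : IsQuasiIsoFamily C D δ ε φ) (hx : x ∈ C.cocycles i) (k : κ) :
    φ k x ∈ (D k).cocycles (i - δ k) :=
  ⟨hφ.map_mem_part k hx.1, (hφ.map_d_mem_null_iff k x).1 (hφ.map_mem_null k hx.2)⟩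

theorem map_mem_coboundaries (hφ : IsQuasiIsoFamily C D δ ε φ) (hx : x ∈ C.coboundaries i)
    (k : κ) : φ k x ∈ (D k).coboundaries (i - δ k) := by
  obtain ⟨y, hy, hxy⟩ := mem_coboundaries.1 hx
  refine mem_coboundaries.2 ⟨ε k • φ k y, ?_, ?_⟩
  · have := hφ.map_mem_part k hy
    rw [sub_right_comm] at this
    exact ((D k).part _).toAddSubgroup.zsmul_mem this _
  · have h := add_mem (hφ.map_mem_null k hxy) (hφ.map_d k y)
    simpa [Units.smul_def] using h

theorem exists_mem_cocycles (hφ : IsQuasiIsoFamily C D δ ε φ) {y : κ → M'}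
    (hy : ∀ k, y k ∈ (D k).cocycles (i - δ k)) :
    ∃ x ∈ C.cocycles i, ∀ k, φ k x - y k ∈ (D k).null := by
  obtain ⟨z, hz, hzy⟩ := hφ.exists_lift i y fun k => (hy k).1
  obtain ⟨w, hw, hφw, hzw⟩ := hφ.acyclic (d_mem_cocycles hz) fun k =>
    (hφ.map_d_mem_null_iff k z).2 (hzy k ▸ (hy k).2)
  rw [add_sub_cancel_right] at hw
  refine ⟨z - w, ⟨(C.part i).sub_mem hz hw, by simpa using hzw⟩, fun k => ?_⟩
  simpa [hzy k] using hφw k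

theorem mem_coboundaries_of_map (hφ : IsQuasiIsoFamily C D δ ε φ) (hx : x ∈ C.cocycles i)
    (hφx : ∀ k, φ k x ∈ (D k).coboundaries (i - δ k)) : x ∈ C.coboundaries i := by
  choose y hy hxy using fun k => mem_coboundaries.1 (hφx k)
  obtain ⟨z, hz, hzy⟩ := hφ.exists_lift (i - 1) (fun k => ε k • y k) fun k => by
    have := ((D k).part _).toAddSubgroup.zsmul_mem (hy k) (ε k : ℤ)
    rwa [sub_right_comm] at this
  obtain ⟨w, hw, -, hzw⟩ := hφ.acyclic (sub_d_mem_cocycles hx hz) fun k => by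
    have h := sub_mem (hxy k) (hφ.map_d k z)
    rw [hzy k, Units.smul_def, Units.smul_def, map_zsmul, smul_smul,
      ← Units.val_mul, Int.units_mul_self, Units.val_one, one_smul] at h
    simpa using h
  exact mem_coboundaries.2 ⟨z + w, (C.part _).add_mem hz hw, by simpa [sub_sub] using hzw⟩

/-- The isomorphism on cohomology induced by a family of cochain maps that is jointly surjective
with acyclic joint kernel. -/
def cohomologyEquiv (hφ : IsQuasiIsoFamily C D δ ε φ) (i : ℤ) :
    C.Cohomology i ≃ₗ[R] ∀ k, (D k).Cohomology (i - δ k) :=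
  subquotientEquiv _ _
    (LinearMap.pi fun k => (((D k).coboundaries (i - δ k)).submoduleOf _).mkQ ∘ₗ
      (φ k).restrict fun _ hx => hφ.map_mem_cocycles hx k)
    (by
      intro q
      choose y hy using fun k => Submodule.mkQ_surjective _ (q k)
      obtain ⟨x, hx, hxy⟩ := hφ.exists_mem_cocycles fun k => (y k).2
      refine ⟨⟨x, hx⟩, funext fun k => (hy k).symm ▸ (Submodule.Quotient.eq _).2 ?_⟩
      exact Submodule.mem_sup_right (hxy k))
    (by
      intro x
      rw [funext_iff]
      simp only [LinearMap.pi_apply, LinearMap.comp_apply, Submodule.mkQ_apply, Pi.zero_apply,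
        Submodule.Quotient.mk_eq_zero]
      exact ⟨hφ.mem_coboundaries_of_map x.2, hφ.map_mem_coboundaries⟩)

end IsQuasiIsoFamily

end PresentedComplex

section Signs

variable {V : Type} [LinearOrder V]

theorem not_edgeLT_iff {e f : Sym2 V} (h : e ≠ f) : ¬ EdgeLT e f ↔ EdgeLT f e := by
  have hne : toLex (f.inf, f.sup) ≠ toLex (e.inf, e.sup) := fun h' =>
    h (Sym2.inf_eq_inf_and_sup_eq_sup.1 (Prod.mk.inj (toLex_inj.1 h'.symm)))
  rw [EdgeLT, EdgeLT, not_lt, hne.le_iff_lt]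

open Classical in
theorem numBefore_eq_card_filter (s : Finset (Sym2 V)) (e : Sym2 V) :
    numBefore s e = (s.filter (EdgeLT · e)).card := by
  rw [numBefore, ← Set.ncard_coe_finset, Finset.coe_filter]

open Classical in
theorem numBefore_insert {s : Finset (Sym2 V)} {e : Sym2 V} (he : e ∉ s) (f : Sym2 V) :
    numBefore (insert e s) f = numBefore s f + if EdgeLT e f then 1 else 0 := by
  rw [numBefore_eq_card_filter, numBefore_eq_card_filter, Finset.filter_insert]
  split_ifs with h
  · exact Finset.card_insert_of_notMem fun h' => he (Finset.mem_filter.1 h').1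
  · rfl

/-- The sign `(-1)^{n(e)}` with which `e` is added to `s`. -/
def edgeSign (s : Finset (Sym2 V)) (e : Sym2 V) : ℤ := (-1) ^ numBefore s e

theorem edgeSign_mul_self (s : Finset (Sym2 V)) (e : Sym2 V) :
    edgeSign s e * edgeSign s e = 1 := by
  rw [edgeSign, ← mul_pow]
  simp

theorem edgeSign_swap {s : Finset (Sym2 V)} {e f : Sym2 V} (he : e ∉ s) (hf : f ∉ s)
    (hef : e ≠ f) :
    edgeSign s e * edgeSign (insert e s) f = -(edgeSign s f * edgeSign (insert f s) e) := by
  unfold edgeSign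
  rw [numBefore_insert he, numBefore_insert hf, ← not_edgeLT_iff hef]
  by_cases h : EdgeLT e f <;> simp only [h, not_true, not_false_eq_true, if_true, if_false] <;>
    ring

end Signs

section Homogeneous

variable {R V W : Type*} [CommSemiring R] {j : ℤ}

variable (R V) in
/-- The polynomials that are homogeneous of degree `j`, for an integer `j`: negative degrees are
allowed, and only contain the zero polynomial. -/
abbrev homogeneousPart (j : ℤ) : Submodule R (MvPolynomial V R) :=
  weightedHomogeneousSubmodule R (fun _ => (1 : ℤ)) j

theorem mem_homogeneousPart {p : MvPolynomial V R} :
    p ∈ homogeneousPart R V j ↔ ∀ m, coeff m p ≠ 0 → (m.degree : ℤ) = j := by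
  simp [IsWeightedHomogeneous, Finsupp.weight_apply, Finsupp.degree_apply, Finsupp.sum]

theorem X_mul_mem_homogeneousPart {p : MvPolynomial V R} (hp : p ∈ homogeneousPart R V j)
    (v : V) : X v * p ∈ homogeneousPart R V (j + 1) := by
  rw [add_comm]
  exact (isWeightedHomogeneous_X R (fun _ => (1 : ℤ)) v).mul hp

theorem prod_X_mem_homogeneousPart {ι : Type*} (f : ι → V) (Y : Finset ι) :
    ∏ i ∈ Y, X (f i) ∈ homogeneousPart R V Y.card := by
  simpa using IsWeightedHomogeneous.prod Y (fun i => X (f i)) (fun _ => (1 : ℤ))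
    fun i _ => isWeightedHomogeneous_X R (fun _ => (1 : ℤ)) (f i)

theorem rename_mem_homogeneousPart {p : MvPolynomial V R} (hp : p ∈ homogeneousPart R V j)
    (g : V → W) : rename g p ∈ homogeneousPart R W j := by
  rw [mem_homogeneousPart] at hp ⊢
  intro m h
  obtain ⟨u, rfl, hu⟩ := coeff_rename_ne_zero g p m h
  rw [Finsupp.degree_mapDomain]
  exact hp u hu

theorem finSuccEquiv_coeff_mem_homogeneousPart {n : ℕ} {p : MvPolynomial (Fin (n + 1)) R}
    (hp : p ∈ homogeneousPart R (Fin (n + 1)) j) (k : ℕ) :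
    (finSuccEquiv R n p).coeff k ∈ homogeneousPart R (Fin n) (j - k) := by
  rw [mem_homogeneousPart] at hp ⊢
  intro m h
  rw [finSuccEquiv_coeff_coeff] at h
  rw [← hp _ h, Finsupp.degree_eq_sum, Finsupp.degree_eq_sum, Fin.sum_univ_succ]
  simp

end Homogeneous

section Squarefree

variable {R σ : Type*} [CommSemiring R]

/-- The exponent of the squarefree monomial with the given support. -/
def sqfreeExp (Y : Finset σ) : σ →₀ ℕ := ∑ v ∈ Y, Finsupp.single v 1

theorem sqfreeExp_apply [DecidableEq σ] (Y : Finset σ) (v : σ) :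
    sqfreeExp Y v = if v ∈ Y then 1 else 0 := by
  simp [sqfreeExp, Finsupp.finsetSum_apply, Finsupp.single_apply]

theorem sqfreeExp_injective : Function.Injective (sqfreeExp (σ := σ)) := by
  classical
  intro Y Z h
  ext v
  have := DFunLike.congr_fun h v
  rw [sqfreeExp_apply, sqfreeExp_apply] at this
  by_cases h1 : v ∈ Y <;> by_cases h2 : v ∈ Z <;> simp_all

theorem sqfreeExp_support {m : σ →₀ ℕ} (hm : ∀ v, m v < 2) : sqfreeExp m.support = m := by
  classical
  ext v
  have := hm v
  rw [sqfreeExp_apply]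
  split_ifs with h <;> simp only [Finsupp.mem_support_iff] at h <;> omega

theorem degree_sqfreeExp (Y : Finset σ) : (sqfreeExp Y).degree = Y.card := by
  simp [sqfreeExp, map_sum]

theorem monomial_sqfreeExp (Y : Finset σ) :
    (monomial (sqfreeExp Y) 1 : MvPolynomial σ R) = ∏ v ∈ Y, X v := by
  rw [sqfreeExp, monomial_sum_one]
  rfl

end Squarefree

/-! ### The polynomial model -/

section ColourIdeal

variable {R V W : Type*} [CommRing R]

variable (R) in
/-- The relations of `⨂ R[x]/(x²)` over the components of `[G : s]`, presented as a quotient of the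
polynomial ring on the vertices: a vertex variable is the `x` of the component of the vertex. -/
def colourIdeal (s : Finset (Sym2 V)) : Ideal (MvPolynomial V R) :=
  Ideal.span ({p | ∃ v, p = X v ^ 2} ∪ {p | ∃ a b, s(a, b) ∈ s ∧ p = X a - X b})

variable {s : Finset (Sym2 V)} {a b : V} {p : MvPolynomial V R}

theorem X_sq_mem_colourIdeal (s : Finset (Sym2 V)) (v : V) : X v ^ 2 ∈ colourIdeal R s :=
  Ideal.subset_span (Or.inl ⟨v, rfl⟩)

theorem X_sub_X_mem_colourIdeal (h : s(a, b) ∈ s) : X a - X b ∈ colourIdeal R s :=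
  Ideal.subset_span (Or.inr ⟨a, b, h, rfl⟩)

theorem colourIdeal_le {I : Ideal (MvPolynomial V R)} (h1 : ∀ v, X v ^ 2 ∈ I)
    (h2 : ∀ a b, s(a, b) ∈ s → X a - X b ∈ I) : colourIdeal R s ≤ I := by
  refine Ideal.span_le.2 ?_
  rintro p (⟨v, rfl⟩ | ⟨a, b, hab, rfl⟩)
  exacts [h1 v, h2 a b hab]

theorem colourIdeal_mono {t : Finset (Sym2 V)} (h : s ⊆ t) : colourIdeal R s ≤ colourIdeal R t :=
  colourIdeal_le (X_sq_mem_colourIdeal t) fun _ _ hab => X_sub_X_mem_colourIdeal (h hab)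

theorem prod_X_mem_colourIdeal {ι : Type*} {f : ι → V} {Y : Finset ι} (h : ¬ Set.InjOn f Y) :
    ∏ i ∈ Y, X (f i) ∈ colourIdeal R s := by
  classical
  simp only [Set.InjOn, not_forall] at h
  obtain ⟨c, hc, c', hc', hcc', hne⟩ := h
  rw [← Finset.mul_prod_erase Y _ hc,
    ← Finset.mul_prod_erase (Y.erase c) _ (Finset.mem_erase.2 ⟨Ne.symm hne, hc'⟩), ← mul_assoc,
    hcc', ← sq]
  exact Ideal.mul_mem_right _ _ (X_sq_mem_colourIdeal s _)

section Insert

variable [DecidableEq V]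

theorem colourIdeal_insert_of_mem (h : X a - X b ∈ colourIdeal R s) :
    colourIdeal R (insert s(a, b) s) = colourIdeal R s := by
  refine le_antisymm (colourIdeal_le (X_sq_mem_colourIdeal s) fun c e hce => ?_)
    (colourIdeal_mono (Finset.subset_insert _ _))
  rcases Finset.mem_insert.1 hce with hce | hce
  · rcases Sym2.eq_iff.1 hce with ⟨rfl, rfl⟩ | ⟨rfl, rfl⟩
    · exact h
    · simpa using (colourIdeal R s).neg_mem h
  · exact X_sub_X_mem_colourIdeal hce

theorem X_add_X_mul_mem_colourIdeal (h : p ∈ colourIdeal R (insert s(a, b) s)) :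
    (X a + X b) * p ∈ colourIdeal R s := by
  have hsub : (X a + X b) * (X a - X b) ∈ colourIdeal R s := by
    rw [← sq_sub_sq]
    exact Ideal.sub_mem _ (X_sq_mem_colourIdeal s a) (X_sq_mem_colourIdeal s b)
  suffices hle : colourIdeal R (insert s(a, b) s) ≤ (colourIdeal R s).colon {X a + X b} by
    rw [mul_comm]
    exact Submodule.mem_colon_singleton.1 (hle h)
  refine colourIdeal_le (fun v => ?_) (fun c e hce => ?_) <;>
    rw [Submodule.mem_colon_singleton, smul_eq_mul, mul_comm]
  · exact Ideal.mul_mem_left _ _ (X_sq_mem_colourIdeal s v)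
  · rcases Finset.mem_insert.1 hce with hce | hce
    · rcases Sym2.eq_iff.1 hce with ⟨rfl, rfl⟩ | ⟨rfl, rfl⟩
      · exact hsub
      · rw [← neg_sub, mul_neg]
        exact Ideal.neg_mem_iff _ |>.2 hsub
    · exact Ideal.mul_mem_left _ _ (X_sub_X_mem_colourIdeal hce)

theorem two_mul_X_mul_mem_colourIdeal {c : V} (hab : p ∈ colourIdeal R (insert s(a, b) s))
    (hac : p ∈ colourIdeal R (insert s(a, c) s)) (hbc : p ∈ colourIdeal R (insert s(b, c) s)) :
    2 * (X a * p) ∈ colourIdeal R s := by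
  have h := sub_mem (add_mem (X_add_X_mul_mem_colourIdeal hab) (X_add_X_mul_mem_colourIdeal hac))
    (X_add_X_mul_mem_colourIdeal hbc)
  convert h using 1
  ring

end Insert

theorem rename_mem_colourIdeal {t : Finset (Sym2 W)} (f : V → W)
    (hf : ∀ a b, s(a, b) ∈ s → X (f a) - X (f b) ∈ colourIdeal R t)
    (hp : p ∈ colourIdeal R s) : rename f p ∈ colourIdeal R t := by
  refine colourIdeal_le (I := (colourIdeal R t).comap (rename (R := R) f)) (fun v => ?_)
    (fun a b hab => ?_) hp
  · rw [Ideal.mem_comap, map_pow, rename_X]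
    exact X_sq_mem_colourIdeal t _
  · rw [Ideal.mem_comap, map_sub, rename_X, rename_X]
    exact hf a b hab

theorem sub_rename_mem_colourIdeal (g : V → V) (hg : ∀ v, X v - X (g v) ∈ colourIdeal R s)
    (p : MvPolynomial V R) : p - rename g p ∈ colourIdeal R s := by
  rw [← Ideal.Quotient.eq]
  have : Ideal.Quotient.mkₐ R (colourIdeal R s) =
      (Ideal.Quotient.mkₐ R (colourIdeal R s)).comp (rename g) := by
    refine algHom_ext fun v => ?_
    rw [AlgHom.comp_apply, rename_X]
    exact Ideal.Quotient.eq.2 (hg v)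
  exact DFunLike.congr_fun this p

theorem prod_X_mem_colourIdeal_of_mem (hab : a ≠ b) (h : s(a, b) ∈ s) {Y : Finset V} (ha : a ∈ Y)
    (hb : b ∈ Y) : ∏ v ∈ Y, X v ∈ colourIdeal R s := by
  classical
  have hg (v : V) : X v - X (Function.update id a b v) ∈ colourIdeal R s := by
    obtain rfl | hv := eq_or_ne v a
    · simpa using X_sub_X_mem_colourIdeal h
    · simp [hv]
  have hmerge := sub_rename_mem_colourIdeal _ hg (∏ v ∈ Y, X v)
  simp only [map_prod, rename_X] at hmerge
  refine ((colourIdeal R s).sub_mem_iff_left (prod_X_mem_colourIdeal fun hinj => ?_)).1 hmerge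
  exact hab (hinj ha hb (by simp [hab.symm]))

theorem mem_colourIdeal_iff_rename_mem {t : Finset (Sym2 W)} (f : V → W) (g : W → V)
    (hf : ∀ a b, s(a, b) ∈ s → X (f a) - X (f b) ∈ colourIdeal R t)
    (hg : ∀ a b, s(a, b) ∈ t → X (g a) - X (g b) ∈ colourIdeal R s)
    (hgf : ∀ v, X v - X (g (f v)) ∈ colourIdeal R s) :
    p ∈ colourIdeal R s ↔ rename f p ∈ colourIdeal R t := by
  refine ⟨rename_mem_colourIdeal f hf, fun h => ?_⟩
  have h' := rename_mem_colourIdeal g hg h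
  rw [rename_rename] at h'
  simpa using add_mem (sub_rename_mem_colourIdeal (g ∘ f) hgf p) h'

theorem mem_colourIdeal_empty_iff :
    p ∈ colourIdeal R (∅ : Finset (Sym2 V)) ↔ ∀ Y, coeff (sqfreeExp Y) p = 0 := by
  classical
  have hgen : colourIdeal R (∅ : Finset (Sym2 V)) =
      Ideal.span ((fun m => monomial m 1) '' Set.range fun v => Finsupp.single v 2) := by
    rw [colourIdeal, ← Set.range_comp]
    congr 1
    ext q
    simp [X_pow_eq_monomial, eq_comm]
  rw [hgen, mem_ideal_span_monomial_image]
  simp only [Set.exists_range_iff, Finsupp.single_le_iff, mem_support_iff]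
  constructor
  · intro h Y
    by_contra hY
    obtain ⟨v, hv⟩ := h _ hY
    rw [sqfreeExp_apply] at hv
    split_ifs at hv <;> omega
  · intro h m hm
    by_contra! hlt
    exact hm (sqfreeExp_support hlt ▸ h m.support)

end ColourIdeal

section Model

variable {R V : Type*} [CommRing R]

variable (R V) in
/-- Families of polynomials indexed by edge sets. The polynomial at `s` represents an element of
`⨂ R[x]/(x²)` over the components of `[G : s]`, the free module on the colourings of `[G : s]`. -/
abbrev PreChain : Type _ := Finset (Sym2 V) → MvPolynomial V R

variable (R) in
/-- The families of polynomials that represent zero in the chromatic complex of `G`. -/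
def nullChains (G : SimpleGraph V) : Submodule R (PreChain R V) where
  carrier := {f | ∀ s : Finset (Sym2 V), (s : Set (Sym2 V)) ⊆ G.edgeSet → f s ∈ colourIdeal R s}
  zero_mem' := fun s _ => (colourIdeal R s).zero_mem
  add_mem' := fun hf hg s hs => (colourIdeal R s).add_mem (hf s hs) (hg s hs)
  smul_mem' := fun a _ hf s hs => Submodule.smul_of_tower_mem _ a (hf s hs)

variable (R V) in
/-- The families of polynomials of bidegree `(i, j)`. -/
def bidegreePart (i j : ℤ) : Submodule R (PreChain R V) where
  carrier := {f | ∀ s : Finset (Sym2 V),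
    (f s ≠ 0 → (s.card : ℤ) = i) ∧ f s ∈ homogeneousPart R V j}
  zero_mem' := fun s => ⟨fun h => absurd rfl h, Submodule.zero_mem _⟩
  add_mem' := by
    intro f g hf hg s
    refine ⟨fun h => ?_, Submodule.add_mem _ (hf s).2 (hg s).2⟩
    by_cases h' : f s = 0
    · exact (hg s).1 (by simpa [h'] using h)
    · exact (hf s).1 h'
  smul_mem' := fun a f hf s =>
    ⟨fun h => (hf s).1 fun h0 => h (by rw [Pi.smul_apply, h0, smul_zero]),
      Submodule.smul_mem _ a (hf s).2⟩

theorem eq_zero_of_mem_bidegreePart_of_neg {i j : ℤ} {f : PreChain R V}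
    (hf : f ∈ bidegreePart R V i j) (hi : i < 0) : f = 0 := by
  funext s
  by_contra h
  have := (hf s).1 h
  omega

theorem single_mem_bidegreePart [DecidableEq V] {j : ℤ} {p : MvPolynomial V R}
    (hp : p ∈ homogeneousPart R V j) (s : Finset (Sym2 V)) :
    Pi.single s p ∈ bidegreePart R V s.card j := by
  intro t
  by_cases ht : t = s
  · subst ht
    rw [Pi.single_eq_same]
    exact ⟨fun _ => rfl, hp⟩
  · rw [Pi.single_eq_of_ne ht]
    exact ⟨fun h => absurd rfl h, Submodule.zero_mem _⟩

end Model

section Differential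

variable {R : Type*} [CommRing R] {V : Type} [LinearOrder V] {G : SimpleGraph V} {i j : ℤ}

/-- The differential on families of polynomials. Adding an edge does not change the representing
polynomial: the products of colours are accounted for by the growth of `colourIdeal`. -/
def preDiff : PreChain R V →ₗ[R] PreChain R V where
  toFun f s := ∑ e ∈ s, edgeSign (s.erase e) e • f (s.erase e)
  map_add' f g := by
    funext s
    simp only [Pi.add_apply, smul_add, Finset.sum_add_distrib]
  map_smul' a f := by
    funext s
    simp only [Pi.smul_apply, RingHom.id_apply, Finset.smul_sum]
    exact Finset.sum_congr rfl fun e _ => smul_comm _ _ _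

theorem preDiff_apply (f : PreChain R V) (s : Finset (Sym2 V)) :
    preDiff f s = ∑ e ∈ s, edgeSign (s.erase e) e • f (s.erase e) := rfl

theorem preDiff_insert (f : PreChain R V) {s : Finset (Sym2 V)} {e : Sym2 V} (he : e ∉ s) :
    preDiff f (insert e s) = edgeSign s e • f s +
      ∑ e' ∈ s, edgeSign (insert e (s.erase e')) e' • f (insert e (s.erase e')) := by
  rw [preDiff_apply, Finset.sum_insert he, Finset.erase_insert he]
  congr 1
  refine Finset.sum_congr rfl fun e' he' => ?_
  have : e ≠ e' := fun h => he (h ▸ he')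
  rw [Finset.erase_insert_of_ne this]

theorem edgeSign_erase_swap {s : Finset (Sym2 V)} {e e' : Sym2 V} (he : e ∈ s)
    (he' : e' ∈ s.erase e) :
    edgeSign (s.erase e) e * edgeSign ((s.erase e).erase e') e' =
      -(edgeSign (s.erase e') e' * edgeSign ((s.erase e').erase e) e) := by
  have hne : e' ≠ e := (Finset.mem_erase.1 he').1
  have h := edgeSign_swap (s := (s.erase e).erase e') (e := e) (f := e') (by simp) (by simp)
    hne.symm
  rw [Finset.insert_erase he', Finset.erase_right_comm,
    Finset.insert_erase (Finset.mem_erase.2 ⟨hne.symm, he⟩)] at h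
  rw [Finset.erase_right_comm]
  linear_combination h

theorem preDiff_preDiff (f : PreChain R V) : preDiff (preDiff f) = 0 := by
  funext s
  simp only [preDiff_apply, Finset.smul_sum, smul_smul, Finset.sum_sigma']
  refine Finset.sum_involution (fun p _ => ⟨p.2, p.1⟩) ?_ ?_ ?_ (fun _ _ => rfl)
  · rintro ⟨e, e'⟩ h
    obtain ⟨he, he'⟩ := Finset.mem_sigma.1 h
    rw [edgeSign_erase_swap he he', Finset.erase_right_comm, neg_smul, neg_add_cancel]
  · rintro ⟨e, e'⟩ h - heq
    obtain ⟨-, he'⟩ := Finset.mem_sigma.1 h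
    exact (Finset.mem_erase.1 he').1 (congrArg Sigma.fst heq)
  · rintro ⟨e, e'⟩ h
    simp only [Finset.mem_sigma, Finset.mem_erase] at h ⊢
    exact ⟨h.2.2, h.2.1.symm, h.1⟩

/-- The contraction of families of polynomials along the edge `e`: a homotopy between the identity
and zero, which need not preserve the families that represent zero. -/
def contraction (e : Sym2 V) : PreChain R V →ₗ[R] PreChain R V where
  toFun f s := if e ∈ s then 0 else edgeSign s e • f (insert e s)
  map_add' f g := by
    funext s
    by_cases h : e ∈ s <;> simp [h]
  map_smul' a f := by
    funext s
    by_cases h : e ∈ s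
    · simp [h]
    · simp [h, smul_comm]

theorem contraction_of_mem {e : Sym2 V} {s : Finset (Sym2 V)} (h : e ∈ s) (f : PreChain R V) :
    contraction e f s = 0 := if_pos h

theorem contraction_of_notMem {e : Sym2 V} {s : Finset (Sym2 V)} (h : e ∉ s) (f : PreChain R V) :
    contraction e f s = edgeSign s e • f (insert e s) := if_neg h

theorem edgeSign_mul_add_eq_zero {s : Finset (Sym2 V)} {e e' : Sym2 V} (he : e ∉ s)
    (he' : e' ∈ s) :
    edgeSign (s.erase e') e' * edgeSign (s.erase e') e +
      edgeSign s e * edgeSign (insert e (s.erase e')) e' = 0 := by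
  have hne : e' ≠ e := fun h => he (h ▸ he')
  have hswap := edgeSign_swap (s := s.erase e') (e := e') (f := e) (by simp)
    (fun h => he (Finset.mem_of_mem_erase h)) hne
  rw [Finset.insert_erase he'] at hswap
  have hs := edgeSign_mul_self s e
  have hs' := edgeSign_mul_self (s.erase e') e
  linear_combination edgeSign s e * edgeSign (s.erase e') e * hswap -
    edgeSign (s.erase e') e' * edgeSign (s.erase e') e * hs -
    edgeSign s e * edgeSign (insert e (s.erase e')) e' * hs'

theorem preDiff_contraction_add (e : Sym2 V) (f : PreChain R V) :
    preDiff (contraction e f) + contraction e (preDiff f) = f := by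
  funext s
  rw [Pi.add_apply]
  by_cases he : e ∈ s
  · rw [contraction_of_mem he, add_zero, preDiff_apply, Finset.sum_eq_single_of_mem e he]
    · rw [contraction_of_notMem (by simp), Finset.insert_erase he, smul_smul, edgeSign_mul_self,
        one_smul]
    · intro e' _ hne
      rw [contraction_of_mem (Finset.mem_erase.2 ⟨hne.symm, he⟩), smul_zero]
  · rw [contraction_of_notMem he, preDiff_insert f he, smul_add, smul_smul, edgeSign_mul_self,
      one_smul, add_comm, add_assoc, preDiff_apply, Finset.smul_sum, ← Finset.sum_add_distrib,
      Finset.sum_eq_zero, add_zero]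
    intro e' he'
    rw [contraction_of_notMem fun h => he (Finset.mem_of_mem_erase h), smul_smul, smul_smul,
      ← add_smul, add_comm, edgeSign_mul_add_eq_zero he he', zero_smul]

theorem preDiff_mem_nullChains {f : PreChain R V} (hf : f ∈ nullChains R G) :
    preDiff f ∈ nullChains R G := by
  intro s hs
  refine (colourIdeal R s).sum_mem fun e _ => zsmul_mem ?_ _
  have hsub : s.erase e ⊆ s := Finset.erase_subset _ _
  exact colourIdeal_mono hsub (hf _ ((Finset.coe_subset.2 hsub).trans hs))

theorem preDiff_mem_bidegreePart {f : PreChain R V} (hf : f ∈ bidegreePart R V i j) :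
    preDiff f ∈ bidegreePart R V (i + 1) j := by
  intro s
  refine ⟨fun h => ?_, Submodule.sum_mem _ fun e _ => zsmul_mem (hf _).2 _⟩
  obtain ⟨e, he, hne⟩ := Finset.exists_ne_zero_of_sum_ne_zero h
  rw [← (hf _).1 (right_ne_zero_of_smul hne), ← Finset.card_erase_add_one he]
  push_cast
  rfl

theorem contraction_mem_bidegreePart {f : PreChain R V} (hf : f ∈ bidegreePart R V i j)
    (e : Sym2 V) : contraction e f ∈ bidegreePart R V (i - 1) j := by
  intro s
  by_cases he : e ∈ s
  · rw [contraction_of_mem he]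
    exact ⟨fun h => absurd rfl h, Submodule.zero_mem _⟩
  · rw [contraction_of_notMem he]
    refine ⟨fun h => ?_, zsmul_mem (hf _).2 _⟩
    rw [← (hf _).1 (right_ne_zero_of_smul h), Finset.card_insert_of_notMem he]
    push_cast
    ring

variable (R) in
/-- The polynomial model of the chromatic complex of `G` in degree `j`, with coefficients in `R`. -/
def model (G : SimpleGraph V) (j : ℤ) : PresentedComplex R (PreChain R V) where
  d := preDiff
  part i := bidegreePart R V i j
  null := nullChains R G
  d_mem_part := preDiff_mem_bidegreePart
  d_mem_null := preDiff_mem_nullChains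
  d_d := preDiff_preDiff

@[simp]
theorem model_d : (model R G j).d = preDiff := rfl

@[simp]
theorem model_null : (model R G j).null = nullChains R G := rfl

end Differential

/-! ### Comparison with the chromatic complex -/

section Components

variable {R : Type*} [CommRing R] {V : Type}

theorem X_sub_X_mem_colourIdeal_of_reachable {s : Finset (Sym2 V)} {a b : V}
    (h : (spanning s).Reachable a b) : X a - X b ∈ colourIdeal R s := by
  obtain ⟨w⟩ := h
  induction w with
  | nil => simp
  | cons hadj _ ih =>
    have h1 := X_sub_X_mem_colourIdeal (R := R) ((SimpleGraph.fromEdgeSet_adj _).1 hadj).1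
    simpa using (colourIdeal R s).add_mem h1 ih

/-- A vertex in a given component. -/
def compRep {s : Finset (Sym2 V)} (c : (spanning s).ConnectedComponent) : V := Quot.out c

theorem mk_compRep {s : Finset (Sym2 V)} (c : (spanning s).ConnectedComponent) :
    (spanning s).connectedComponentMk (compRep c) = c := Quot.out_eq c

variable (R) in
/-- The polynomial that represents the colouring of `[G : s]` with set `Y` of `x`-coloured
components. -/
def compMonomial {s : Finset (Sym2 V)} (Y : Finset (spanning s).ConnectedComponent) :
    MvPolynomial V R := ∏ c ∈ Y, X (compRep c)

variable (R) in
/-- The coefficient, in an element of `⨂ R[x]/(x²)` represented by a polynomial, of the colouring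
of `[G : s]` with set `Y` of `x`-coloured components. -/
def compCoeff {s : Finset (Sym2 V)} (Y : Finset (spanning s).ConnectedComponent) :
    MvPolynomial V R →ₗ[R] R :=
  lcoeff R (sqfreeExp Y) ∘ₗ (rename (spanning s).connectedComponentMk).toLinearMap

theorem compCoeff_apply {s : Finset (Sym2 V)} (Y : Finset (spanning s).ConnectedComponent)
    (p : MvPolynomial V R) :
    compCoeff R Y p = coeff (sqfreeExp Y) (rename (spanning s).connectedComponentMk p) := rfl

open Classical in
theorem compCoeff_compMonomial {s : Finset (Sym2 V)}
    (Y Z : Finset (spanning s).ConnectedComponent) :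
    compCoeff R Y (compMonomial R Z) = if Z = Y then 1 else 0 := by
  rw [compCoeff_apply, compMonomial, map_prod]
  simp only [rename_X, mk_compRep]
  rw [← monomial_sqfreeExp, coeff_monomial]
  simp only [sqfreeExp_injective.eq_iff]

theorem mem_colourIdeal_iff {s : Finset (Sym2 V)} {p : MvPolynomial V R} :
    p ∈ colourIdeal R s ↔
      ∀ Y : Finset (spanning s).ConnectedComponent, compCoeff R Y p = 0 := by
  simp only [compCoeff_apply]
  rw [← mem_colourIdeal_empty_iff]
  refine mem_colourIdeal_iff_rename_mem (spanning s).connectedComponentMk compRep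
    (fun a b hab => ?_) (by simp) fun v => ?_
  · suffices h : (spanning s).connectedComponentMk a = (spanning s).connectedComponentMk b by
      simp [h]
    by_cases h : a = b
    · rw [h]
    · exact SimpleGraph.ConnectedComponent.eq.2
        (SimpleGraph.Adj.reachable ((SimpleGraph.fromEdgeSet_adj _).2 ⟨hab, h⟩))
  · exact X_sub_X_mem_colourIdeal_of_reachable
      (SimpleGraph.ConnectedComponent.eq.1 (mk_compRep _).symm)

theorem bidegree_eq_of_compCoeff_ne_zero {i j : ℤ} {f : PreChain R V}
    (hf : f ∈ bidegreePart R V i j) {s : Finset (Sym2 V)}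
    {Y : Finset (spanning s).ConnectedComponent} (h : compCoeff R Y (f s) ≠ 0) :
    (s.card : ℤ) = i ∧ (Y.card : ℤ) = j := by
  refine ⟨(hf s).1 fun h0 => h (by rw [h0, map_zero]), ?_⟩
  rw [← degree_sqfreeExp]
  exact mem_homogeneousPart.1 (rename_mem_homogeneousPart (hf s).2 _) _ h

end Components

section AddEdge

variable {R : Type*} [CommRing R] {V : Type} [LinearOrder V] {s : Finset (Sym2 V)} {e : Sym2 V}

theorem compMonomial_sub_prod_mem (Y : Finset (spanning s).ConnectedComponent) :
    compMonomial R Y - ∏ c ∈ Y, X (compRep (compMap s e c)) ∈ colourIdeal R (insert e s) := by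
  rw [← Ideal.Quotient.eq, compMonomial, map_prod, map_prod]
  refine Finset.prod_congr rfl fun c _ => Ideal.Quotient.eq.2
    (X_sub_X_mem_colourIdeal_of_reachable (SimpleGraph.ConnectedComponent.eq.1 ?_))
  rw [mk_compRep]
  conv_rhs => rw [← mk_compRep c]
  rfl

open Classical in
theorem compMonomial_sub_compMonomial_image_mem {Y : Finset (spanning s).ConnectedComponent}
    (h : Set.InjOn (compMap s e) Y) :
    compMonomial R Y - compMonomial R (Y.image (compMap s e)) ∈ colourIdeal R (insert e s) := by
  rw [compMonomial.eq_def R (Y.image _), Finset.prod_image h]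
  exact compMonomial_sub_prod_mem Y

theorem compMonomial_mem_colourIdeal {Y : Finset (spanning s).ConnectedComponent}
    (h : ¬ Set.InjOn (compMap s e) Y) : compMonomial R Y ∈ colourIdeal R (insert e s) := by
  rw [← (colourIdeal R _).sub_mem_iff_left (prod_X_mem_colourIdeal fun h' => h h'.of_comp)]
  exact compMonomial_sub_prod_mem Y

theorem preDiff_single [Fintype V] (s : Finset (Sym2 V)) (p : MvPolynomial V R) :
    preDiff (Pi.single s p) =
      ∑ e : Sym2 V, if e ∈ s then 0 else edgeSign s e • Pi.single (insert e s) p := by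
  funext t
  have hsum (g : Sym2 V → MvPolynomial V R) :
      ∑ e ∈ t, g e = ∑ e : Sym2 V, if e ∈ t then g e else 0 := by simp
  rw [preDiff_apply, Finset.sum_apply, hsum]
  refine Finset.sum_congr rfl fun e _ => ?_
  by_cases h : e ∉ s ∧ t = insert e s
  · obtain ⟨he, rfl⟩ := h
    simp [he]
  · have h1 : (if e ∈ s then 0 else edgeSign s e • Pi.single (insert e s) p :
        PreChain R V) t = 0 := by
      split_ifs with he
      · rfl
      · rw [Pi.smul_apply, Pi.single_eq_of_ne fun ht => h ⟨he, ht⟩, smul_zero]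
    rw [h1, ite_eq_right_iff]
    intro het
    rw [Pi.single_eq_of_ne, smul_zero]
    rintro rfl
    exact h ⟨Finset.notMem_erase e t, (Finset.insert_erase het).symm⟩

end AddEdge

section Comparison

variable {V : Type} [LinearOrder V] {G : SimpleGraph V} {i : ℕ} {j : ℤ}

theorem single_mem_nullChains {R : Type*} [CommRing R] {s : Finset (Sym2 V)}
    {p : MvPolynomial V R} (h : (s : Set (Sym2 V)) ⊆ G.edgeSet → p ∈ colourIdeal R s) :
    Pi.single s p ∈ nullChains R G := by
  intro t ht
  by_cases hst : t = s
  · subst hst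
    rw [Pi.single_eq_same]
    exact h ht
  · rw [Pi.single_eq_of_ne hst]
    exact Ideal.zero_mem _

/-- The family of polynomials that represents an enhanced state. -/
def stateFamily (S : EnhancedState G) : PreChain ℤ V := Pi.single S.s (compMonomial ℤ S.xs)

/-- The comparison map from the chromatic complex to the polynomial model. -/
def toModel (G : SimpleGraph V) (i : ℕ) (j : ℤ) : (OfBidegree G i j →₀ ℤ) →ₗ[ℤ] PreChain ℤ V :=
  Finsupp.linearCombination ℤ fun S => stateFamily S.1

theorem toModel_single (S : OfBidegree G i j) (a : ℤ) :
    toModel G i j (Finsupp.single S a) = a • stateFamily S.1 :=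
  Finsupp.linearCombination_single _ _ _

theorem stateFamily_mem_bidegreePart (S : OfBidegree G i j) :
    stateFamily S.1 ∈ bidegreePart ℤ V i j := by
  obtain ⟨S, rfl, rfl⟩ := S
  exact single_mem_bidegreePart (prod_X_mem_homogeneousPart compRep S.xs) S.s

theorem toModel_mem_bidegreePart (c : OfBidegree G i j →₀ ℤ) :
    toModel G i j c ∈ bidegreePart ℤ V i j :=
  Submodule.sum_mem _ fun S _ => Submodule.smul_mem _ _ (stateFamily_mem_bidegreePart S)

theorem compCoeff_toModel (S : OfBidegree G i j) (c : OfBidegree G i j →₀ ℤ) :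
    compCoeff ℤ S.1.xs (toModel G i j c S.1.s) = c S := by
  classical
  induction c using Finsupp.induction_linear with
  | zero => simp
  | add c c' h h' => rw [map_add, Pi.add_apply, map_add, h, h', Finsupp.add_apply]
  | single S' a =>
    rw [toModel_single, Pi.smul_apply, map_smul, Finsupp.single_apply, stateFamily]
    obtain ⟨⟨s, hs, xs⟩, hS⟩ := S
    obtain ⟨⟨s', hs', xs'⟩, hS'⟩ := S'
    by_cases h : s = s'
    · subst h
      simp [compCoeff_compMonomial]
    · simp [h, Ne.symm h]

theorem eq_zero_of_toModel_mem {c : OfBidegree G i j →₀ ℤ} (h : toModel G i j c ∈ nullChains ℤ G) :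
    c = 0 := by
  ext S
  rw [← compCoeff_toModel S c]
  exact mem_colourIdeal_iff.1 (h _ S.1.s_subset) _

instance [Finite V] : Finite (EnhancedState G) := by
  refine Finite.of_injective (β := Σ s : Finset (Sym2 V), Finset (spanning s).ConnectedComponent)
    (fun S => ⟨S.s, S.xs⟩) fun S S' h => ?_
  obtain ⟨hs, hxs⟩ := Sigma.mk.inj h
  exact EnhancedState.ext hs hxs

theorem exists_toModel_sub_mem [Finite V] {f : PreChain ℤ V} (hf : f ∈ bidegreePart ℤ V i j) :
    ∃ c, toModel G i j c - f ∈ nullChains ℤ G := by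
  let c : OfBidegree G i j →₀ ℤ :=
    Finsupp.equivFunOnFinite.symm fun S => compCoeff ℤ S.1.xs (f S.1.s)
  refine ⟨c, fun s hs => mem_colourIdeal_iff.2 fun Y => ?_⟩
  by_contra h
  obtain ⟨hsi, hYj⟩ := bidegree_eq_of_compCoeff_ne_zero
    (Submodule.sub_mem _ (toModel_mem_bidegreePart c) hf) h
  refine h ?_
  rw [Pi.sub_apply, map_sub, sub_eq_zero]
  exact compCoeff_toModel (⟨⟨s, hs, Y⟩, by exact_mod_cast hsi, hYj⟩ : OfBidegree G i j) c

variable [Fintype V]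

theorem preDiff_stateFamily_sub_mem (S : OfBidegree G i j) :
    preDiff (stateFamily S.1) - toModel G (i + 1) j (diffState S) ∈ nullChains ℤ G := by
  classical
  rw [stateFamily, preDiff_single, diffState, map_sum, ← Finset.sum_sub_distrib]
  refine Submodule.sum_mem _ fun e _ => ?_
  by_cases hes : e ∈ S.1.s
  · rw [if_pos hes, dif_neg fun h => h.2.1 hes, map_zero, sub_zero]
    exact Submodule.zero_mem _
  rw [if_neg hes]
  by_cases heG : e ∈ G.edgeSet
  swap
  · rw [dif_neg fun h => heG h.1, map_zero, sub_zero]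
    exact Submodule.smul_mem _ _ (single_mem_nullChains fun h => absurd (h (by simp)) heG)
  by_cases hS : S.1.Survives e
  · rw [dif_pos ⟨heG, hes, hS⟩, toModel_single, edgeSign, ← smul_sub, stateFamily]
    refine Submodule.smul_mem _ _ ?_
    have := single_mem_nullChains (G := G) fun _ =>
      compMonomial_sub_compMonomial_image_mem (R := ℤ) hS
    rwa [Pi.single_sub] at this
  · rw [dif_neg fun h => hS h.2.2, map_zero, sub_zero]
    exact Submodule.smul_mem _ _ (single_mem_nullChains fun _ => compMonomial_mem_colourIdeal hS)

theorem preDiff_toModel_sub_mem (c : Chain G i j) :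
    preDiff (toModel G i j c) - toModel G (i + 1) j (diff G i j c) ∈ nullChains ℤ G := by
  induction c using Finsupp.induction_linear with
  | zero => simp
  | add c c' h h' =>
    rw [map_add, map_add, map_add, map_add, add_sub_add_comm]
    exact Submodule.add_mem _ h h'
  | single S a =>
    rw [toModel_single, map_smul, diff, Finsupp.linearCombination_single, map_smul, ← smul_sub]
    exact Submodule.smul_mem _ _ (preDiff_stateFamily_sub_mem S)

theorem diff_eq_iff (c : Chain G i j) (c' : Chain G (i + 1) j) :
    diff G i j c = c' ↔ toModel G (i + 1) j c' - preDiff (toModel G i j c) ∈ nullChains ℤ G := by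
  have h := preDiff_toModel_sub_mem c
  rw [← Submodule.add_mem_iff_left _ h, sub_add_sub_cancel, ← map_sub]
  refine ⟨fun hc => by simp [hc], fun hc => (sub_eq_zero.1 (eq_zero_of_toModel_mem hc)).symm⟩

theorem toModel_mem_coboundaries_iff (c : Chain G i j) :
    toModel G i j c ∈ (model ℤ G j).coboundaries i ↔ c ∈ boundaries G i j := by
  rw [PresentedComplex.mem_coboundaries]
  cases i with
  | zero =>
    rw [boundaries, Submodule.mem_bot]
    constructor
    · rintro ⟨y, hy, h⟩
      rw [eq_zero_of_mem_bidegreePart_of_neg hy (by simp), map_zero, sub_zero] at h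
      exact eq_zero_of_toModel_mem h
    · rintro rfl
      exact ⟨0, Submodule.zero_mem _, by simp⟩
  | succ i =>
    rw [boundaries, LinearMap.mem_range, Nat.cast_succ, add_sub_cancel_right]
    simp only [diff_eq_iff]
    constructor
    · rintro ⟨y, hy, h⟩
      obtain ⟨b, hb⟩ := exists_toModel_sub_mem (G := G) hy
      have h1 := preDiff_mem_nullChains hb
      rw [map_sub] at h1
      exact ⟨b, by simpa using Submodule.sub_mem _ h h1⟩
    · rintro ⟨b, hb⟩
      exact ⟨_, toModel_mem_bidegreePart b, hb⟩

/-- Chromatic homology is the cohomology of the polynomial model. -/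
def homologyEquivModel (G : SimpleGraph V) (i : ℕ) (j : ℤ) :
    H G i j ≃ₗ[ℤ] (model ℤ G j).Cohomology i :=
  subquotientCongr _ _ _ _ (toModel G i j)
    (fun c hc => ⟨toModel_mem_bidegreePart c, by
      simpa using (diff_eq_iff c 0).1 hc⟩)
    (fun c _ => toModel_mem_coboundaries_iff c)
    (by
      rintro f ⟨hf, hdf⟩
      obtain ⟨c, hc⟩ := exists_toModel_sub_mem (G := G) hf
      refine ⟨c, (diff_eq_iff c 0).2 ?_, Submodule.mem_sup_right hc⟩
      have h1 := preDiff_mem_nullChains hc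
      rw [map_sub] at h1
      simpa using Submodule.add_mem _ h1 hdf)

end Comparison

/-! ### Complete graphs and the edges at the first vertex -/

section Edges

variable {m : ℕ}

/-- The inclusion of the edges of `K m` into the edges of `K (m + 1)` avoiding the vertex `0`. -/
def succEdge (m : ℕ) : Sym2 (Fin m) ↪ Sym2 (Fin (m + 1)) := (Fin.succEmb m).sym2Map

/-- An edge set of `K m`, regarded as an edge set of `K (m + 1)` avoiding the vertex `0`. -/
def succEdges (s : Finset (Sym2 (Fin m))) : Finset (Sym2 (Fin (m + 1))) := s.map (succEdge m)

/-- The edge set of `K (m + 1)` consisting of `s` and the edge from `0` to `k`. -/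
def starEdges (k : Fin m) (s : Finset (Sym2 (Fin m))) : Finset (Sym2 (Fin (m + 1))) :=
  insert s(0, k.succ) (succEdges s)

@[simp]
theorem succEdge_mk (a b : Fin m) : succEdge m s(a, b) = s(a.succ, b.succ) := rfl

theorem zero_notMem_succEdge (e : Sym2 (Fin m)) : 0 ∉ succEdge m e := by
  induction e with | h a b =>
  simp [(Fin.succ_ne_zero _).symm]

theorem zero_notMem_of_mem_succEdges {s : Finset (Sym2 (Fin m))} {e : Sym2 (Fin (m + 1))}
    (he : e ∈ succEdges s) : 0 ∉ e := by
  obtain ⟨e', _, rfl⟩ := Finset.mem_map.1 he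
  exact zero_notMem_succEdge e'

theorem star_notMem_succEdges (k : Fin m) (s : Finset (Sym2 (Fin m))) :
    s(0, k.succ) ∉ succEdges s := fun h => zero_notMem_of_mem_succEdges h (by simp)

theorem succEdges_erase (s : Finset (Sym2 (Fin m))) (e : Sym2 (Fin m)) :
    (succEdges s).erase (succEdge m e) = succEdges (s.erase e) := (Finset.map_erase _ _ _).symm

theorem mk_mem_succEdges {s : Finset (Sym2 (Fin m))} {a b : Fin (m + 1)} :
    s(a, b) ∈ succEdges s ↔ ∃ a' b', a = Fin.succ a' ∧ b = Fin.succ b' ∧ s(a', b') ∈ s := by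
  constructor
  · intro h
    obtain ⟨e, he, heq⟩ := Finset.mem_map.1 h
    induction e with | h c d =>
    rw [succEdge_mk] at heq
    rcases Sym2.eq_iff.1 heq with ⟨rfl, rfl⟩ | ⟨rfl, rfl⟩
    · exact ⟨c, d, rfl, rfl, he⟩
    · exact ⟨d, c, rfl, rfl, Sym2.eq_swap ▸ he⟩
  · rintro ⟨a, b, rfl, rfl, h⟩
    exact Finset.mem_map_of_mem (succEdge m) h

theorem edgeLT_succEdge {e f : Sym2 (Fin m)} :
    EdgeLT (succEdge m e) (succEdge m f) ↔ EdgeLT e f := by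
  have hinf : ∀ e : Sym2 (Fin m), (succEdge m e).inf = e.inf.succ := fun e => by
    induction e with | h a b => exact (Fin.strictMono_succ.monotone.map_min).symm
  have hsup : ∀ e : Sym2 (Fin m), (succEdge m e).sup = e.sup.succ := fun e => by
    induction e with | h a b => exact (Fin.strictMono_succ.monotone.map_max).symm
  simp [EdgeLT, Prod.Lex.toLex_lt_toLex, hinf, hsup]

theorem edgeLT_star_succEdge (k : Fin m) (e : Sym2 (Fin m)) :
    EdgeLT s(0, k.succ) (succEdge m e) := by
  induction e with | h a b =>
  refine Prod.Lex.toLex_lt_toLex.2 (Or.inl ?_)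
  simp [Fin.succ_pos]

theorem numBefore_succEdges (s : Finset (Sym2 (Fin m))) (e : Sym2 (Fin m)) :
    numBefore (succEdges s) (succEdge m e) = numBefore s e := by
  classical
  rw [numBefore_eq_card_filter, numBefore_eq_card_filter, succEdges, Finset.filter_map,
    Finset.card_map]
  simp only [Function.comp_def, edgeLT_succEdge]

theorem edgeSign_succEdges (s : Finset (Sym2 (Fin m))) (e : Sym2 (Fin m)) :
    edgeSign (succEdges s) (succEdge m e) = edgeSign s e := by
  rw [edgeSign, edgeSign, numBefore_succEdges]

theorem edgeSign_starEdges (k : Fin m) (s : Finset (Sym2 (Fin m))) (e : Sym2 (Fin m)) :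
    edgeSign (starEdges k s) (succEdge m e) = -edgeSign s e := by
  rw [edgeSign, starEdges, numBefore_insert (star_notMem_succEdges k s),
    if_pos (edgeLT_star_succEdge k e), numBefore_succEdges, pow_succ, edgeSign]
  ring

theorem edgeSign_succEdges_star (k : Fin m) (s : Finset (Sym2 (Fin m))) :
    edgeSign (succEdges s) s(0, k.succ) = 1 := by
  classical
  rw [edgeSign, numBefore_eq_card_filter, Finset.card_eq_zero.2, pow_zero]
  refine Finset.filter_eq_empty_iff.2 fun f hf hlt => ?_
  obtain ⟨f', _, rfl⟩ := Finset.mem_map.1 hf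
  exact lt_asymm hlt (edgeLT_star_succEdge k f')

theorem subset_edgeSet_K {n : ℕ} {s : Finset (Sym2 (Fin n))} :
    (s : Set (Sym2 (Fin n))) ⊆ (K n).edgeSet ↔ ∀ e ∈ s, ¬ e.IsDiag := by
  simp only [Set.subset_def, Finset.mem_coe, SimpleGraph.edgeSet_top, Set.mem_compl_iff]
  rfl

theorem succEdges_subset_iff {s : Finset (Sym2 (Fin m))} :
    (succEdges s : Set (Sym2 (Fin (m + 1)))) ⊆ (K (m + 1)).edgeSet ↔
      (s : Set (Sym2 (Fin m))) ⊆ (K m).edgeSet := by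
  have : ∀ e : Sym2 (Fin m), (succEdge m e).IsDiag ↔ e.IsDiag := fun e => by
    induction e with | h a b => simp
  rw [subset_edgeSet_K, subset_edgeSet_K]
  simp only [succEdges, Finset.forall_mem_map, this]

theorem starEdges_subset_iff {k : Fin m} {s : Finset (Sym2 (Fin m))} :
    (starEdges k s : Set (Sym2 (Fin (m + 1)))) ⊆ (K (m + 1)).edgeSet ↔
      (s : Set (Sym2 (Fin m))) ⊆ (K m).edgeSet := by
  rw [← succEdges_subset_iff (s := s), starEdges, Finset.coe_insert, Set.insert_subset_iff,
    and_iff_right]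
  simp [(Fin.succ_ne_zero _).symm]

theorem card_succEdges (s : Finset (Sym2 (Fin m))) : (succEdges s).card = s.card :=
  Finset.card_map _

theorem card_starEdges (k : Fin m) (s : Finset (Sym2 (Fin m))) :
    (starEdges k s).card = s.card + 1 := by
  rw [starEdges, Finset.card_insert_of_notMem (star_notMem_succEdges k s), card_succEdges]

theorem succEdges_injective : Function.Injective (succEdges (m := m)) :=
  Finset.map_injective _

theorem starEdges_injective (k : Fin m) : Function.Injective (starEdges k) := by
  intro s t h
  apply succEdges_injective
  rw [← Finset.erase_insert (star_notMem_succEdges k s), ← starEdges, h, starEdges,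
    Finset.erase_insert (star_notMem_succEdges k t)]

theorem starEdges_ne_succEdges (k : Fin m) (s t : Finset (Sym2 (Fin m))) :
    starEdges k s ≠ succEdges t := fun h =>
  star_notMem_succEdges k t (h ▸ Finset.mem_insert_self _ _)

theorem starEdges_ne_starEdges {k l : Fin m} (hkl : k ≠ l) (s t : Finset (Sym2 (Fin m))) :
    starEdges k s ≠ starEdges l t := by
  intro h
  have : s(0, k.succ) ∈ starEdges l t := h ▸ Finset.mem_insert_self _ _
  rcases Finset.mem_insert.1 this with heq | hmem
  · rcases Sym2.eq_iff.1 heq with ⟨_, heq⟩ | ⟨heq, _⟩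
    · exact hkl (Fin.succ_injective _ heq)
    · exact Fin.succ_ne_zero _ heq.symm
  · exact star_notMem_succEdges k t hmem

/-- The edges at the vertex `0`. -/
def star (s : Finset (Sym2 (Fin (m + 1)))) : Finset (Sym2 (Fin (m + 1))) := s.filter (0 ∈ ·)

theorem star_succEdges (s : Finset (Sym2 (Fin m))) : star (succEdges s) = ∅ :=
  Finset.filter_eq_empty_iff.2 fun _ => zero_notMem_of_mem_succEdges

theorem star_insert_of_notMem {e : Sym2 (Fin (m + 1))} (he : 0 ∉ e)
    (s : Finset (Sym2 (Fin (m + 1)))) : star (insert e s) = star s := by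
  rw [star, Finset.filter_insert, if_neg he, star]

theorem star_erase_of_notMem {e : Sym2 (Fin (m + 1))} (he : 0 ∉ e)
    (s : Finset (Sym2 (Fin (m + 1)))) : star (s.erase e) = star s := by
  rw [star, Finset.filter_erase, Finset.erase_eq_of_notMem, star]
  exact fun h => he (Finset.mem_filter.1 h).2

theorem card_star_erase_lt {e : Sym2 (Fin (m + 1))} (he : 0 ∈ e)
    {s : Finset (Sym2 (Fin (m + 1)))} (hes : e ∈ s) : (star (s.erase e)).card < (star s).card := by
  rw [star, Finset.filter_erase]
  exact Finset.card_erase_lt_of_mem (Finset.mem_filter.2 ⟨hes, he⟩)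

theorem card_star_starEdges (k : Fin m) (s : Finset (Sym2 (Fin m))) :
    (star (starEdges k s)).card = 1 := by
  rw [starEdges, star, Finset.filter_insert, if_pos (by simp), ← star, star_succEdges]
  rfl

theorem exists_succEdges_of_star_eq_empty {s : Finset (Sym2 (Fin (m + 1)))} (hs : star s = ∅) :
    ∃ t, s = succEdges t := by
  refine ⟨s.preimage (succEdge m) (succEdge m).injective.injOn, ?_⟩
  ext e
  simp only [succEdges, Finset.mem_map, Finset.mem_preimage]
  refine ⟨fun he => ?_, ?_⟩
  · have h0 := Finset.filter_eq_empty_iff.1 hs he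
    induction e with | h a b =>
    simp only [Sym2.mem_iff, not_or] at h0
    obtain ⟨a, rfl⟩ := Fin.exists_succ_eq.2 (Ne.symm h0.1)
    obtain ⟨b, rfl⟩ := Fin.exists_succ_eq.2 (Ne.symm h0.2)
    exact ⟨s(a, b), he, rfl⟩
  · rintro ⟨e, he, rfl⟩
    exact he

theorem exists_eq_star_of_mem {e : Sym2 (Fin (m + 1))} (h0 : 0 ∈ e) (he : ¬ e.IsDiag) :
    ∃ k : Fin m, e = s(0, k.succ) := by
  obtain ⟨b, rfl⟩ := h0
  have hb : b ≠ 0 := fun h => he (by simp [h])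
  obtain ⟨k, rfl⟩ := Fin.exists_succ_eq.2 hb
  exact ⟨k, rfl⟩

theorem exists_starEdges_of_card_star_eq_one {s : Finset (Sym2 (Fin (m + 1)))}
    (hs : (s : Set (Sym2 (Fin (m + 1)))) ⊆ (K (m + 1)).edgeSet) (h1 : (star s).card = 1) :
    ∃ k t, s = starEdges k t := by
  obtain ⟨e, he⟩ := Finset.card_eq_one.1 h1
  have hmem : e ∈ star s := by simp [he]
  obtain ⟨hes, h0⟩ := Finset.mem_filter.1 hmem
  obtain ⟨k, rfl⟩ := exists_eq_star_of_mem h0 (subset_edgeSet_K.1 hs e hes)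
  obtain ⟨t, ht⟩ := exists_succEdges_of_star_eq_empty (s := s.erase s(0, k.succ))
    (Finset.card_eq_zero.1 (by have := card_star_erase_lt h0 hes; omega))
  exact ⟨k, t, by rw [starEdges, ← ht, Finset.insert_erase hes]⟩

theorem exists_two_star_edges {s : Finset (Sym2 (Fin (m + 1)))}
    (hs : (s : Set (Sym2 (Fin (m + 1)))) ⊆ (K (m + 1)).edgeSet) (h2 : 2 ≤ (star s).card) :
    ∃ k l : Fin m, k ≠ l ∧ s(0, k.succ) ∈ star s ∧ s(0, l.succ) ∈ star s := by
  obtain ⟨e, he, f, hf, hne⟩ := Finset.one_lt_card.1 h2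
  obtain ⟨hes, he0⟩ := Finset.mem_filter.1 he
  obtain ⟨hfs, hf0⟩ := Finset.mem_filter.1 hf
  obtain ⟨k, rfl⟩ := exists_eq_star_of_mem he0 (subset_edgeSet_K.1 hs e hes)
  obtain ⟨l, rfl⟩ := exists_eq_star_of_mem hf0 (subset_edgeSet_K.1 hs f hfs)
  exact ⟨k, l, fun h => hne (by rw [h]), he, hf⟩

end Edges

section VertexIdeals

variable {R : Type*} {m : ℕ}

theorem finSuccEquiv_rename_succ [CommSemiring R] (p : MvPolynomial (Fin m) R) :
    finSuccEquiv R m (rename Fin.succ p) = Polynomial.C p := by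
  induction p using MvPolynomial.induction_on with
  | C a => rw [rename_C, ← algebraMap_eq, AlgEquiv.commutes]; rfl
  | add p q hp hq => simp only [map_add, hp, hq]
  | mul_X p v hp => rw [map_mul, map_mul, hp, rename_X, finSuccEquiv_X_succ, map_mul]

theorem exists_eq_add_X_zero_sq_mul [CommSemiring R] (p : MvPolynomial (Fin (m + 1)) R) :
    ∃ r, p = rename Fin.succ ((finSuccEquiv R m p).coeff 0) +
      X 0 * rename Fin.succ ((finSuccEquiv R m p).coeff 1) + X 0 ^ 2 * r := by
  set P := finSuccEquiv R m p with hP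
  refine ⟨(finSuccEquiv R m).symm P.divX.divX, (finSuccEquiv R m).injective ?_⟩
  rw [map_add, map_add, map_mul, map_mul, map_pow, finSuccEquiv_rename_succ,
    finSuccEquiv_rename_succ, finSuccEquiv_X_zero, AlgEquiv.apply_symm_apply, ← hP]
  have h1 := P.divX_mul_X_add
  have h2 := P.divX.divX_mul_X_add
  rw [Polynomial.coeff_divX, zero_add] at h2
  nth_rewrite 1 [← h1, ← h2]
  ring

variable [CommRing R] {s : Finset (Sym2 (Fin m))}

theorem rename_succ_mem_colourIdeal {p : MvPolynomial (Fin m) R} (hp : p ∈ colourIdeal R s) :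
    rename Fin.succ p ∈ colourIdeal R (succEdges s) :=
  rename_mem_colourIdeal _ (fun a b hab => X_sub_X_mem_colourIdeal
    (mk_mem_succEdges.2 ⟨a, b, rfl, rfl, hab⟩)) hp

variable {p : MvPolynomial (Fin (m + 1)) R}

theorem finSuccEquiv_coeff_mem_of_mem_succEdges (hp : p ∈ colourIdeal R (succEdges s)) :
    (finSuccEquiv R m p).coeff 0 ∈ colourIdeal R s ∧
      (finSuccEquiv R m p).coeff 1 ∈ colourIdeal R s := by
  refine Submodule.span_induction ?_ (by simp) ?_ ?_ hp
  · rintro p (⟨v, rfl⟩ | ⟨a, b, hab, rfl⟩)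
    · cases v using Fin.cases with
      | zero => simp [finSuccEquiv_X_zero, Polynomial.coeff_X_pow]
      | succ v =>
        rw [map_pow, finSuccEquiv_X_succ, ← map_pow, Polynomial.coeff_C_zero,
          Polynomial.coeff_C_of_ne_zero one_ne_zero]
        exact ⟨X_sq_mem_colourIdeal s v, Ideal.zero_mem _⟩
    · obtain ⟨a, b, rfl, rfl, hab'⟩ := mk_mem_succEdges.1 hab
      rw [map_sub, finSuccEquiv_X_succ, finSuccEquiv_X_succ, ← map_sub,
        Polynomial.coeff_C_zero, Polynomial.coeff_C_of_ne_zero one_ne_zero]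
      exact ⟨X_sub_X_mem_colourIdeal hab', Ideal.zero_mem _⟩
  · intro x y _ _ hx hy
    rw [map_add, Polynomial.coeff_add, Polynomial.coeff_add]
    exact ⟨Ideal.add_mem _ hx.1 hy.1, Ideal.add_mem _ hx.2 hy.2⟩
  · intro a x _ hx
    rw [smul_eq_mul, map_mul, Polynomial.mul_coeff_zero, Polynomial.mul_coeff_one]
    exact ⟨Ideal.mul_mem_left _ _ hx.1,
      Ideal.add_mem _ (Ideal.mul_mem_left _ _ hx.2) (Ideal.mul_mem_left _ _ hx.1)⟩

theorem mem_colourIdeal_succEdges_iff :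
    p ∈ colourIdeal R (succEdges s) ↔
      (finSuccEquiv R m p).coeff 0 ∈ colourIdeal R s ∧
        (finSuccEquiv R m p).coeff 1 ∈ colourIdeal R s := by
  refine ⟨finSuccEquiv_coeff_mem_of_mem_succEdges, ?_⟩
  rintro ⟨h0, h1⟩
  obtain ⟨r, hr⟩ := exists_eq_add_X_zero_sq_mul p
  rw [hr]
  exact Ideal.add_mem _ (Ideal.add_mem _ (rename_succ_mem_colourIdeal h0)
    (Ideal.mul_mem_left _ _ (rename_succ_mem_colourIdeal h1)))
    (Ideal.mul_mem_right _ _ (X_sq_mem_colourIdeal _ _))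

/-- The map of vertices identifying `0` with `k`. -/
def mergeVertex (k : Fin m) : Fin (m + 1) → Fin m := Fin.cases k id

@[simp]
theorem mergeVertex_zero (k : Fin m) : mergeVertex k 0 = k := rfl

@[simp]
theorem mergeVertex_succ (k v : Fin m) : mergeVertex k v.succ = v := rfl

theorem rename_mergeVertex_rename_succ (k : Fin m) (p : MvPolynomial (Fin m) R) :
    rename (mergeVertex k) (rename Fin.succ p) = p := by
  rw [rename_rename]
  exact rename_id_apply p

theorem mem_colourIdeal_starEdges_iff {k : Fin m} :
    p ∈ colourIdeal R (starEdges k s) ↔ rename (mergeVertex k) p ∈ colourIdeal R s := by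
  refine mem_colourIdeal_iff_rename_mem _ Fin.succ (fun a b hab => ?_) (fun a b hab => ?_)
    (fun v => ?_)
  · rcases Finset.mem_insert.1 hab with hab | hab
    · rcases Sym2.eq_iff.1 hab with ⟨rfl, rfl⟩ | ⟨rfl, rfl⟩ <;> simp
    · obtain ⟨a, b, rfl, rfl, hab'⟩ := mk_mem_succEdges.1 hab
      exact X_sub_X_mem_colourIdeal hab'
  · exact X_sub_X_mem_colourIdeal (Finset.mem_insert_of_mem
      (mk_mem_succEdges.2 ⟨a, b, rfl, rfl, hab⟩))
  · cases v using Fin.cases with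
    | zero => exact X_sub_X_mem_colourIdeal (Finset.mem_insert_self _ _)
    | succ v => simp

theorem rename_mergeVertex_sub_mem (k : Fin m) (s : Finset (Sym2 (Fin m)))
    (p : MvPolynomial (Fin (m + 1)) R) :
    rename (mergeVertex k) p -
      ((finSuccEquiv R m p).coeff 0 + X k * (finSuccEquiv R m p).coeff 1) ∈
        colourIdeal R s := by
  obtain ⟨r, hr⟩ := exists_eq_add_X_zero_sq_mul p
  nth_rewrite 1 [hr]
  simp only [map_add, map_mul, map_pow, rename_mergeVertex_rename_succ, rename_X,
    mergeVertex_zero, add_sub_cancel_left]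
  exact Ideal.mul_mem_right _ _ (X_sq_mem_colourIdeal s k)

end VertexIdeals

section RemoveVertex

variable {R : Type*} [CommRing R] {m : ℕ}

/-- The `X 0`-linear part of a family on the edge sets avoiding the vertex `0`. -/
def linearPart : PreChain R (Fin (m + 1)) →ₗ[R] PreChain R (Fin m) where
  toFun f s := (finSuccEquiv R m (f (succEdges s))).coeff 1
  map_add' f g := funext fun s => by simp
  map_smul' a f := funext fun s => by simp

/-- The part of a family on the edge sets whose only edge at `0` is the one to `k`. -/
def starPart (k : Fin m) : PreChain R (Fin (m + 1)) →ₗ[R] PreChain R (Fin m) where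
  toFun f s := rename (mergeVertex k) (f (starEdges k s))
  map_add' f g := funext fun s => by simp
  map_smul' a f := funext fun s => by simp

theorem linearPart_apply (f : PreChain R (Fin (m + 1))) (s : Finset (Sym2 (Fin m))) :
    linearPart f s = (finSuccEquiv R m (f (succEdges s))).coeff 1 := rfl

theorem starPart_apply (k : Fin m) (f : PreChain R (Fin (m + 1))) (s : Finset (Sym2 (Fin m))) :
    starPart k f s = rename (mergeVertex k) (f (starEdges k s)) := rfl

theorem preDiff_succEdges (f : PreChain R (Fin (m + 1))) (s : Finset (Sym2 (Fin m))) :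
    preDiff f (succEdges s) = ∑ e ∈ s, edgeSign (s.erase e) e • f (succEdges (s.erase e)) := by
  rw [preDiff_apply]
  conv_lhs => rw [succEdges, Finset.sum_map]
  refine Finset.sum_congr rfl fun e _ => ?_
  rw [← succEdges, succEdges_erase, edgeSign_succEdges]

theorem preDiff_starEdges (f : PreChain R (Fin (m + 1))) (k : Fin m) (s : Finset (Sym2 (Fin m))) :
    preDiff f (starEdges k s) = f (succEdges s) -
      ∑ e ∈ s, edgeSign (s.erase e) e • f (starEdges k (s.erase e)) := by
  rw [starEdges, preDiff_insert f (star_notMem_succEdges k s), edgeSign_succEdges_star, one_smul,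
    sub_eq_add_neg, ← Finset.sum_neg_distrib]
  congr 1
  conv_lhs => rw [succEdges, Finset.sum_map]
  refine Finset.sum_congr rfl fun e _ => ?_
  rw [← succEdges, succEdges_erase, ← starEdges, edgeSign_starEdges, neg_smul]

theorem linearPart_preDiff (f : PreChain R (Fin (m + 1))) :
    linearPart (preDiff f) = preDiff (linearPart f) := by
  funext s
  rw [linearPart_apply, preDiff_succEdges, preDiff_apply, map_sum, Polynomial.finsetSum_coeff]
  refine Finset.sum_congr rfl fun e _ => ?_
  rw [map_zsmul, Polynomial.coeff_smul, linearPart_apply]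

theorem starPart_preDiff (k : Fin m) (f : PreChain R (Fin (m + 1))) (s : Finset (Sym2 (Fin m))) :
    starPart k (preDiff f) s =
      rename (mergeVertex k) (f (succEdges s)) - preDiff (starPart k f) s := by
  rw [starPart_apply, preDiff_starEdges, preDiff_apply, map_sub, map_sum]
  congr 1
  refine Finset.sum_congr rfl fun e _ => ?_
  rw [map_zsmul, starPart_apply]

variable {i j : ℤ}

theorem linearPart_mem_bidegreePart {f : PreChain R (Fin (m + 1))}
    (hf : f ∈ bidegreePart R (Fin (m + 1)) i j) :
    linearPart f ∈ bidegreePart R (Fin m) i (j - 1) := by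
  intro s
  refine ⟨fun h => ?_, ?_⟩
  · rw [← card_succEdges]
    refine (hf _).1 fun h0 => h ?_
    rw [linearPart_apply, h0, map_zero, Polynomial.coeff_zero]
  · exact_mod_cast finSuccEquiv_coeff_mem_homogeneousPart (hf (succEdges s)).2 1

theorem starPart_mem_bidegreePart {f : PreChain R (Fin (m + 1))}
    (hf : f ∈ bidegreePart R (Fin (m + 1)) i j) (k : Fin m) :
    starPart k f ∈ bidegreePart R (Fin m) (i - 1) j := by
  intro s
  refine ⟨fun h => ?_, rename_mem_homogeneousPart (hf _).2 _⟩
  have := (hf (starEdges k s)).1 fun h0 => h (by rw [starPart_apply, h0, map_zero])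
  rw [card_starEdges] at this
  push_cast at this
  omega

theorem linearPart_mem_nullChains {f : PreChain R (Fin (m + 1))}
    (hf : f ∈ nullChains R (K (m + 1))) : linearPart f ∈ nullChains R (K m) := fun _ hs =>
  (mem_colourIdeal_succEdges_iff.1 (hf _ (succEdges_subset_iff.2 hs))).2

theorem starPart_mem_nullChains {f : PreChain R (Fin (m + 1))} (hf : f ∈ nullChains R (K (m + 1)))
    (k : Fin m) : starPart k f ∈ nullChains R (K m) := fun _ hs =>
  mem_colourIdeal_starEdges_iff.1 (hf _ (starEdges_subset_iff.2 hs))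

/-- The family on the edge sets of `K (m + 1)` avoiding `0` given by `F`, and zero elsewhere. -/
def extendSucc (F : Finset (Sym2 (Fin m)) → MvPolynomial (Fin (m + 1)) R) :
    PreChain R (Fin (m + 1)) := Function.extend succEdges F 0

/-- The family given by `F` on the edge sets whose only edge at `0` is the one to `k`, and zero
elsewhere. -/
def extendStar (k : Fin m) (F : Finset (Sym2 (Fin m)) → MvPolynomial (Fin (m + 1)) R) :
    PreChain R (Fin (m + 1)) := Function.extend (starEdges k) F 0

variable {F : Finset (Sym2 (Fin m)) → MvPolynomial (Fin (m + 1)) R}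

theorem extendSucc_succEdges (s : Finset (Sym2 (Fin m))) : extendSucc F (succEdges s) = F s :=
  succEdges_injective.extend_apply _ _ _

theorem extendSucc_of_ne {t : Finset (Sym2 (Fin (m + 1)))} (h : ∀ s, t ≠ succEdges s) :
    extendSucc F t = 0 :=
  Function.extend_apply' _ _ _ fun ⟨s, hs⟩ => h s hs.symm

theorem extendStar_starEdges (k : Fin m) (s : Finset (Sym2 (Fin m))) :
    extendStar k F (starEdges k s) = F s :=
  (starEdges_injective k).extend_apply _ _ _

theorem extendStar_of_ne {k : Fin m} {t : Finset (Sym2 (Fin (m + 1)))}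
    (h : ∀ s, t ≠ starEdges k s) : extendStar k F t = 0 :=
  Function.extend_apply' _ _ _ fun ⟨s, hs⟩ => h s hs.symm

theorem extendSucc_mem_bidegreePart
    (hF : ∀ s, (F s ≠ 0 → (s.card : ℤ) = i) ∧ F s ∈ homogeneousPart R (Fin (m + 1)) j) :
    extendSucc F ∈ bidegreePart R (Fin (m + 1)) i j := by
  intro t
  by_cases ht : ∃ s, t = succEdges s
  · obtain ⟨s, rfl⟩ := ht
    rw [extendSucc_succEdges, card_succEdges]
    exact hF s
  · rw [extendSucc_of_ne (not_exists.1 ht)]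
    exact ⟨fun h => absurd rfl h, Submodule.zero_mem _⟩

theorem extendStar_mem_bidegreePart {k : Fin m}
    (hF : ∀ s, (F s ≠ 0 → (s.card : ℤ) = i - 1) ∧ F s ∈ homogeneousPart R (Fin (m + 1)) j) :
    extendStar k F ∈ bidegreePart R (Fin (m + 1)) i j := by
  intro t
  by_cases ht : ∃ s, t = starEdges k s
  · obtain ⟨s, rfl⟩ := ht
    rw [extendStar_starEdges, card_starEdges]
    refine ⟨fun h => ?_, (hF s).2⟩
    have := (hF s).1 h
    push_cast
    omega
  · rw [extendStar_of_ne (not_exists.1 ht)]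
    exact ⟨fun h => absurd rfl h, Submodule.zero_mem _⟩

theorem linearPart_extendStar (k : Fin m) : linearPart (extendStar k F) = 0 := by
  funext s
  rw [linearPart_apply, extendStar_of_ne fun t => (starEdges_ne_succEdges k t s).symm, map_zero,
    Polynomial.coeff_zero, Pi.zero_apply]

theorem starPart_extendSucc (k : Fin m) : starPart k (extendSucc F) = 0 := by
  funext s
  rw [starPart_apply, extendSucc_of_ne fun t => starEdges_ne_succEdges k s t, map_zero,
    Pi.zero_apply]

theorem starPart_extendStar_of_ne {k l : Fin m} (h : k ≠ l) :
    starPart k (extendStar l F) = 0 := by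
  funext s
  rw [starPart_apply, extendStar_of_ne fun t => starEdges_ne_starEdges h s t, map_zero,
    Pi.zero_apply]

theorem starPart_extendStar_rename (k : Fin m) (c : PreChain R (Fin m)) :
    starPart k (extendStar k fun s => rename Fin.succ (c s)) = c := by
  funext s
  rw [starPart_apply, extendStar_starEdges, rename_mergeVertex_rename_succ]

theorem linearPart_extendSucc_X_mul (a : PreChain R (Fin m)) :
    linearPart (extendSucc fun s => X 0 * rename Fin.succ (a s)) = a := by
  funext s
  rw [linearPart_apply, extendSucc_succEdges, map_mul, finSuccEquiv_X_zero,
    finSuccEquiv_rename_succ, Polynomial.coeff_X_mul, Polynomial.coeff_C_zero]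

theorem linearPart_extendSucc_rename (a : PreChain R (Fin m)) :
    linearPart (extendSucc fun s => rename Fin.succ (a s)) = 0 := by
  funext s
  rw [linearPart_apply, extendSucc_succEdges, finSuccEquiv_rename_succ,
    Polynomial.coeff_C_of_ne_zero one_ne_zero, Pi.zero_apply]

end RemoveVertex

section StarDiff

variable {R : Type*} [CommRing R] {r : ℕ} {i j : ℤ}

/-- The difference of the parts of a family belonging to the edges from `0` to `k + 1` and to the
first vertex of `K (r + 1)`. -/
def starDiff (k : Fin r) : PreChain R (Fin (r + 1 + 1)) →ₗ[R] PreChain R (Fin (r + 1)) :=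
  starPart k.succ - starPart 0

theorem starDiff_apply (k : Fin r) (f : PreChain R (Fin (r + 1 + 1))) :
    starDiff k f = starPart k.succ f - starPart 0 f := rfl

theorem starDiff_mem_bidegreePart {f : PreChain R (Fin (r + 1 + 1))}
    (hf : f ∈ bidegreePart R _ i j) (k : Fin r) : starDiff k f ∈ bidegreePart R _ (i - 1) j :=
  Submodule.sub_mem _ (starPart_mem_bidegreePart hf _) (starPart_mem_bidegreePart hf _)

theorem starDiff_mem_nullChains {f : PreChain R (Fin (r + 1 + 1))}
    (hf : f ∈ nullChains R (K (r + 1 + 1))) (k : Fin r) : starDiff k f ∈ nullChains R (K (r + 1)) :=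
  Submodule.sub_mem _ (starPart_mem_nullChains hf _) (starPart_mem_nullChains hf _)

theorem starDiff_preDiff (k : Fin r) (f : PreChain R (Fin (r + 1 + 1))) :
    starDiff k (preDiff f) - ((fun s => (X k.succ - X 0) * linearPart f s) -
      preDiff (starDiff k f)) ∈ nullChains R (K (r + 1)) := by
  intro s _
  have h1 := rename_mergeVertex_sub_mem k.succ s (f (succEdges s))
  have h2 := rename_mergeVertex_sub_mem 0 s (f (succEdges s))
  convert Ideal.sub_mem _ h1 h2 using 1
  simp only [starDiff_apply, map_sub, Pi.sub_apply, starPart_preDiff, linearPart_apply]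
  ring

theorem exists_linearPart_starDiff {a : PreChain R (Fin (r + 1))}
    {c : Fin r → PreChain R (Fin (r + 1))}
    (ha : a ∈ bidegreePart R _ i (j - 1)) (hc : ∀ k, c k ∈ bidegreePart R _ (i - 1) j) :
    ∃ f ∈ bidegreePart R (Fin (r + 1 + 1)) i j, linearPart f = a ∧ ∀ k, starDiff k f = c k := by
  refine ⟨extendSucc (fun s => X 0 * rename Fin.succ (a s)) +
    ∑ k : Fin r, extendStar k.succ (fun s => rename Fin.succ (c k s)), ?_, ?_, ?_⟩
  · refine Submodule.add_mem _ (extendSucc_mem_bidegreePart fun s => ⟨fun h => ?_, ?_⟩)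
      (Submodule.sum_mem _ fun k _ => extendStar_mem_bidegreePart fun s => ⟨fun h => ?_, ?_⟩)
    · exact (ha s).1 fun h0 => h (by rw [h0, map_zero, mul_zero])
    · simpa using X_mul_mem_homogeneousPart (rename_mem_homogeneousPart (ha s).2 Fin.succ) 0
    · exact (hc k s).1 fun h0 => h (by rw [h0, map_zero])
    · exact rename_mem_homogeneousPart (hc k s).2 _
  · rw [map_add, linearPart_extendSucc_X_mul, map_sum]
    simp only [linearPart_extendStar, Finset.sum_const_zero, add_zero]
  · intro k
    rw [starDiff_apply, map_add, map_add, map_sum, map_sum, starPart_extendSucc,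
      starPart_extendSucc, Finset.sum_eq_single k, starPart_extendStar_rename]
    · simp [starPart_extendStar_of_ne (Fin.succ_ne_zero _).symm]
    · intro l _ hl
      exact starPart_extendStar_of_ne fun h => hl (Fin.succ_injective _ h).symm
    · simp

end StarDiff

/-! ### Acyclicity of the part with at least two edges at the first vertex -/

section Acyclic

variable {R : Type*} [CommRing R] {m : ℕ} {i j : ℤ}

/-- The family `f` represents zero on the edge sets of `K (m + 1)` that have fewer than `t` edges
at the vertex `0`. -/
def NullBelow (t : ℕ) (f : PreChain R (Fin (m + 1))) : Prop :=
  ∀ s : Finset (Sym2 (Fin (m + 1))), (s : Set _) ⊆ (K (m + 1)).edgeSet →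
    (star s).card < t → f s ∈ colourIdeal R s

/-- An edge that closes a triangle with two of the edges at `0` in `T`, if there are two such edges.
It is chosen once for every `T`, and is applied to `T = star s`, which does not change when an edge
avoiding `0` is added to `s` or removed from it. -/
def closingEdge (T : Finset (Sym2 (Fin (m + 1)))) : Sym2 (Fin (m + 1)) :=
  Classical.epsilon fun e => ∃ k l : Fin m,
    k ≠ l ∧ s(0, k.succ) ∈ T ∧ s(0, l.succ) ∈ T ∧ e = s(k.succ, l.succ)

/-- The contraction along `closingEdge`, on the edge sets with exactly `t` edges at `0`. -/
def starContraction (t : ℕ) (f : PreChain R (Fin (m + 1))) : PreChain R (Fin (m + 1)) :=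
  fun s => if (star s).card = t then contraction (closingEdge (star s)) f s else 0

theorem starContraction_mem_bidegreePart {f : PreChain R (Fin (m + 1))}
    (hf : f ∈ bidegreePart R _ i j) (t : ℕ) :
    starContraction t f ∈ bidegreePart R _ (i - 1) j := by
  intro s
  rw [starContraction]
  split_ifs
  · exact contraction_mem_bidegreePart hf _ s
  · exact ⟨fun h => absurd rfl h, Submodule.zero_mem _⟩

theorem starContraction_of_card_ne {t : ℕ} {s : Finset (Sym2 (Fin (m + 1)))}
    (h : (star s).card ≠ t) (f : PreChain R (Fin (m + 1))) : starContraction t f s = 0 :=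
  if_neg h

section ClosingEdge

variable {s : Finset (Sym2 (Fin (m + 1)))}

theorem exists_closingEdge_eq (hs : (s : Set _) ⊆ (K (m + 1)).edgeSet) (h2 : 2 ≤ (star s).card) :
    ∃ k l : Fin m, k ≠ l ∧ s(0, k.succ) ∈ s ∧ s(0, l.succ) ∈ s ∧
      closingEdge (star s) = s(k.succ, l.succ) := by
  obtain ⟨k, l, hkl, hk, hl⟩ := exists_two_star_edges hs h2
  obtain ⟨k, l, hkl, hk, hl, he⟩ := Classical.epsilon_spec (p := fun e => ∃ k l : Fin m,
    k ≠ l ∧ s(0, k.succ) ∈ star s ∧ s(0, l.succ) ∈ star s ∧ e = s(k.succ, l.succ))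
    ⟨_, k, l, hkl, hk, hl, rfl⟩
  exact ⟨k, l, hkl, (Finset.mem_filter.1 hk).1, (Finset.mem_filter.1 hl).1, he⟩

theorem zero_notMem_closingEdge (hs : (s : Set _) ⊆ (K (m + 1)).edgeSet)
    (h2 : 2 ≤ (star s).card) : 0 ∉ closingEdge (star s) := by
  obtain ⟨k, l, -, -, -, he⟩ := exists_closingEdge_eq hs h2
  simp [he, (Fin.succ_ne_zero _).symm]

theorem insert_closingEdge_subset (hs : (s : Set _) ⊆ (K (m + 1)).edgeSet)
    (h2 : 2 ≤ (star s).card) :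
    ((insert (closingEdge (star s)) s : Finset _) : Set _) ⊆ (K (m + 1)).edgeSet := by
  obtain ⟨k, l, hkl, -, -, he⟩ := exists_closingEdge_eq hs h2
  rw [Finset.coe_insert]
  exact Set.insert_subset (by simpa [he] using hkl) hs

theorem colourIdeal_insert_closingEdge (hs : (s : Set _) ⊆ (K (m + 1)).edgeSet)
    (h2 : 2 ≤ (star s).card) :
    colourIdeal R (insert (closingEdge (star s)) s) = colourIdeal R s := by
  obtain ⟨k, l, -, hk, hl, he⟩ := exists_closingEdge_eq hs h2
  rw [he]
  refine colourIdeal_insert_of_mem ?_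
  simpa using Ideal.sub_mem _ (X_sub_X_mem_colourIdeal hl) (X_sub_X_mem_colourIdeal hk)

end ClosingEdge

theorem contraction_apply_mem {V : Type} [LinearOrder V] {e : Sym2 V} {s : Finset (Sym2 V)}
    {f : PreChain R V} {I : Ideal (MvPolynomial V R)} (h : f (insert e s) ∈ I) :
    contraction e f s ∈ I := by
  by_cases he : e ∈ s
  · rw [contraction_of_mem he]
    exact I.zero_mem
  · rw [contraction_of_notMem he]
    exact zsmul_mem h _

theorem contraction_closingEdge_erase_mem {f : PreChain R (Fin (m + 1))}
    {s : Finset (Sym2 (Fin (m + 1)))} (hf : NullBelow (star s).card f)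
    (hs : (s : Set _) ⊆ (K (m + 1)).edgeSet) (h2 : 2 ≤ (star s).card) {e : Sym2 (Fin (m + 1))}
    (he : e ∈ s) (h0 : 0 ∈ e) :
    contraction (closingEdge (star s)) f (s.erase e) ∈ colourIdeal R s := by
  have hsub : insert (closingEdge (star s)) (s.erase e) ⊆ insert (closingEdge (star s)) s :=
    Finset.insert_subset_insert _ (Finset.erase_subset _ _)
  refine contraction_apply_mem ?_
  rw [← colourIdeal_insert_closingEdge hs h2]
  refine colourIdeal_mono hsub
    (hf _ ((Finset.coe_subset.2 hsub).trans (insert_closingEdge_subset hs h2)) ?_)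
  rw [star_insert_of_notMem (zero_notMem_closingEdge hs h2)]
  exact card_star_erase_lt h0 he

/-- Removing an edge at `0` leaves an edge set with fewer edges at `0`, so to leading order the
differential does not see these edges and the contraction along `closingEdge` is a homotopy. -/
theorem preDiff_contraction_sub_starContraction_mem {f : PreChain R (Fin (m + 1))}
    {s : Finset (Sym2 (Fin (m + 1)))} (hf : NullBelow (star s).card f)
    (hs : (s : Set _) ⊆ (K (m + 1)).edgeSet) (h2 : 2 ≤ (star s).card) :
    preDiff (contraction (closingEdge (star s)) f) s -
      preDiff (starContraction (star s).card f) s ∈ colourIdeal R s := by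
  rw [preDiff_apply, preDiff_apply, ← Finset.sum_sub_distrib]
  refine Ideal.sum_mem _ fun e he => ?_
  rw [← smul_sub]
  refine zsmul_mem ?_ _
  by_cases h0 : 0 ∈ e
  · rw [starContraction_of_card_ne (card_star_erase_lt h0 he).ne, sub_zero]
    exact contraction_closingEdge_erase_mem hf hs h2 he h0
  · rw [starContraction, star_erase_of_notMem h0, if_pos rfl, sub_self]
    exact Ideal.zero_mem _

theorem NullBelow.sub_preDiff_starContraction {f : PreChain R (Fin (m + 1))} {t : ℕ}
    (hf : NullBelow t f) (hd : preDiff f ∈ nullChains R (K (m + 1))) (ht : 2 ≤ t) :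
    NullBelow (t + 1) (f - preDiff (starContraction t f)) := by
  intro s hs hst
  rcases Nat.lt_succ_iff_lt_or_eq.1 hst with hlt | rfl
  · rw [Pi.sub_apply, preDiff_apply, Finset.sum_eq_zero, sub_zero]
    · exact hf s hs hlt
    · intro e _
      have : (star (s.erase e)).card ≤ (star s).card :=
        Finset.card_le_card (Finset.filter_subset_filter _ (Finset.erase_subset _ _))
      rw [starContraction_of_card_ne (by omega), smul_zero]
  · have hcontr : contraction (closingEdge (star s)) (preDiff f) s ∈ colourIdeal R s := by
      refine contraction_apply_mem ?_
      rw [← colourIdeal_insert_closingEdge hs ht]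
      exact hd _ (insert_closingEdge_subset hs ht)
    have hhomotopy := congrFun (preDiff_contraction_add (closingEdge (star s)) f) s
    rw [Pi.add_apply] at hhomotopy
    rw [Pi.sub_apply, ← hhomotopy]
    convert Ideal.add_mem _ hcontr (preDiff_contraction_sub_starContraction_mem hf hs ht) using 1
    abel

theorem sub_preDiff_mem_bidegreePart {V : Type} [LinearOrder V] {f y : PreChain R V}
    (hf : f ∈ bidegreePart R V i j) (hy : y ∈ bidegreePart R V (i - 1) j) :
    f - preDiff y ∈ bidegreePart R V i j :=
  Submodule.sub_mem _ hf (by simpa using preDiff_mem_bidegreePart hy)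

theorem exists_nullBelow_sub_preDiff {f : PreChain R (Fin (m + 1))} (hf : f ∈ bidegreePart R _ i j)
    (hd : preDiff f ∈ nullChains R (K (m + 1))) (h2 : NullBelow 2 f) {t : ℕ} (ht : 2 ≤ t) :
    ∃ y ∈ bidegreePart R (Fin (m + 1)) (i - 1) j, (∀ s, (star s).card < 2 → y s = 0) ∧
      NullBelow t (f - preDiff y) := by
  induction t, ht using Nat.le_induction with
  | base => exact ⟨0, Submodule.zero_mem _, fun _ _ => rfl, by simpa using h2⟩
  | succ t ht ih =>
    obtain ⟨y, hy, hy0, hyt⟩ := ih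
    refine ⟨y + starContraction t (f - preDiff y), Submodule.add_mem _ hy
      (starContraction_mem_bidegreePart (sub_preDiff_mem_bidegreePart hf hy) t),
      fun s hs => ?_, ?_⟩
    · rw [Pi.add_apply, hy0 s hs, starContraction_of_card_ne (by omega), add_zero]
    · rw [map_add, ← sub_sub]
      exact hyt.sub_preDiff_starContraction (by rwa [map_sub, preDiff_preDiff, sub_zero]) ht

theorem exists_sub_preDiff_mem_nullChains {f : PreChain R (Fin (m + 1))}
    (hf : f ∈ bidegreePart R _ i j) (hd : preDiff f ∈ nullChains R (K (m + 1)))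
    (h2 : NullBelow 2 f) :
    ∃ y ∈ bidegreePart R (Fin (m + 1)) (i - 1) j, (∀ s, (star s).card < 2 → y s = 0) ∧
      f - preDiff y ∈ nullChains R (K (m + 1)) := by
  obtain ⟨y, hy, hy0, h⟩ := exists_nullBelow_sub_preDiff hf hd h2
    (t := Fintype.card (Sym2 (Fin (m + 1))) + 2) (by omega)
  refine ⟨y, hy, hy0, fun s hs => h s hs ?_⟩
  have := Finset.card_le_univ (star s)
  omega

end Acyclic

section Kernel

variable {R : Type*} [CommRing R] {m r : ℕ} {i j : ℤ}

theorem preDiff_extendSucc_rename (a : PreChain R (Fin m)) (s : Finset (Sym2 (Fin m))) :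
    preDiff (extendSucc fun s => rename Fin.succ (a s)) (succEdges s) =
      rename Fin.succ (preDiff a s) := by
  rw [preDiff_succEdges, preDiff_apply, map_sum]
  refine Finset.sum_congr rfl fun e _ => ?_
  rw [extendSucc_succEdges, map_zsmul]

theorem extendSucc_rename_mem_bidegreePart {a : PreChain R (Fin m)}
    (ha : a ∈ bidegreePart R _ i j) :
    (extendSucc fun s => rename Fin.succ (a s)) ∈ bidegreePart R _ i j :=
  extendSucc_mem_bidegreePart fun s => ⟨fun h => (ha s).1 fun h0 => h (by rw [h0, map_zero]),
    rename_mem_homogeneousPart (ha s).2 _⟩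

/-- If all parts of a cycle `f` at the vertex `0` agree up to null families, with common value
`starPart 0 f`, then subtracting the boundary of this value removes all of them. -/
theorem nullBelow_two_sub_preDiff_extendSucc {f : PreChain R (Fin (r + 1 + 1))}
    (hd : preDiff f ∈ nullChains R (K (r + 1 + 1)))
    (hlin : linearPart f ∈ nullChains R (K (r + 1)))
    (hstar : ∀ k, starDiff k f ∈ nullChains R (K (r + 1))) :
    NullBelow 2 (f - preDiff (extendSucc fun s => rename Fin.succ (starPart 0 f s))) := by
  intro s hs hs2
  obtain hs0 | hs1 : (star s).card = 0 ∨ (star s).card = 1 := by omega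
  · obtain ⟨s, rfl⟩ := exists_succEdges_of_star_eq_empty (Finset.card_eq_zero.1 hs0)
    have hs' := succEdges_subset_iff.1 hs
    have hl := hlin s hs'
    rw [linearPart_apply] at hl
    rw [Pi.sub_apply, preDiff_extendSucc_rename, mem_colourIdeal_succEdges_iff, map_sub,
      finSuccEquiv_rename_succ, Polynomial.coeff_sub, Polynomial.coeff_sub,
      Polynomial.coeff_C_zero, Polynomial.coeff_C_of_ne_zero one_ne_zero, sub_zero]
    refine ⟨?_, hl⟩
    have hmerge := starPart_mem_nullChains hd 0 s hs'
    rw [starPart_preDiff] at hmerge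
    have hexpand := rename_mergeVertex_sub_mem 0 s (f (succEdges s))
    convert Ideal.sub_mem _ (Ideal.sub_mem _ hmerge hexpand) (Ideal.mul_mem_left _ (X 0) hl)
      using 1
    ring
  · obtain ⟨k, s, rfl⟩ := exists_starEdges_of_card_star_eq_one hs hs1
    rw [mem_colourIdeal_starEdges_iff, ← starPart_apply, map_sub, Pi.sub_apply, starPart_preDiff,
      starPart_extendSucc, map_zero, Pi.zero_apply, sub_zero, extendSucc_succEdges,
      rename_mergeVertex_rename_succ]
    have hs' := starEdges_subset_iff.1 hs
    cases k using Fin.cases with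
    | zero => simp
    | succ k => exact hstar k s hs'

theorem linearPart_eq_zero {y : PreChain R (Fin (m + 1))}
    (hy : ∀ s, (star s).card < 2 → y s = 0) : linearPart y = 0 := by
  funext s
  rw [linearPart_apply, hy _ (by simp [star_succEdges]), map_zero, Polynomial.coeff_zero,
    Pi.zero_apply]

theorem starPart_eq_zero {y : PreChain R (Fin (m + 1))}
    (hy : ∀ s, (star s).card < 2 → y s = 0) (k : Fin m) : starPart k y = 0 := by
  funext s
  rw [starPart_apply, hy _ (by simp [card_star_starEdges]), map_zero, Pi.zero_apply]

theorem exists_preDiff_of_parts {f : PreChain R (Fin (r + 1 + 1))} (hf : f ∈ bidegreePart R _ i j)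
    (hd : preDiff f ∈ nullChains R (K (r + 1 + 1)))
    (hlin : linearPart f ∈ nullChains R (K (r + 1)))
    (hstar : ∀ k, starDiff k f ∈ nullChains R (K (r + 1))) :
    ∃ y ∈ bidegreePart R (Fin (r + 1 + 1)) (i - 1) j, linearPart y = 0 ∧
      (∀ k, starDiff k y = 0) ∧ f - preDiff y ∈ nullChains R (K (r + 1 + 1)) := by
  set y : PreChain R (Fin (r + 1 + 1)) :=
    extendSucc fun s => rename Fin.succ (starPart 0 f s) with hy
  have hydeg : y ∈ bidegreePart R _ (i - 1) j :=
    extendSucc_rename_mem_bidegreePart (starPart_mem_bidegreePart hf 0)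
  obtain ⟨z, hz, hz0, h⟩ := exists_sub_preDiff_mem_nullChains
    (sub_preDiff_mem_bidegreePart hf hydeg) (by rwa [map_sub, preDiff_preDiff, sub_zero])
    (nullBelow_two_sub_preDiff_extendSucc hd hlin hstar)
  refine ⟨y + z, Submodule.add_mem _ hydeg hz, ?_, fun k => ?_, ?_⟩
  · rw [map_add, hy, linearPart_extendSucc_rename, linearPart_eq_zero hz0, add_zero]
  · rw [map_add, hy, starDiff_apply, starPart_extendSucc, starPart_extendSucc, starDiff_apply,
      starPart_eq_zero hz0, starPart_eq_zero hz0, sub_zero, add_zero]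
  · rwa [map_add, ← sub_sub]

end Kernel

/-! ### The recursion -/

section Homotopy

variable {R : Type*} [CommRing R] {V : Type} [LinearOrder V] {G : SimpleGraph V} {i j : ℤ}

/-- For an edge `{a, b}` of a graph, a homotopy between multiplication by `X a + X b` and zero. -/
def edgeHomotopy (a b : V) : PreChain R V →ₗ[R] PreChain R V where
  toFun f s := (X a + X b) * contraction s(a, b) f s
  map_add' f g := by
    funext s
    simp only [map_add, Pi.add_apply, mul_add]
  map_smul' c f := by
    funext s
    simp only [map_smul, Pi.smul_apply, mul_smul_comm, RingHom.id_apply]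

theorem edgeHomotopy_apply (a b : V) (f : PreChain R V) (s : Finset (Sym2 V)) :
    edgeHomotopy a b f s = (X a + X b) * contraction s(a, b) f s := rfl

theorem preDiff_edgeHomotopy_add (a b : V) (f : PreChain R V) (s : Finset (Sym2 V)) :
    preDiff (edgeHomotopy a b f) s + edgeHomotopy a b (preDiff f) s = (X a + X b) * f s := by
  conv_rhs => rw [← preDiff_contraction_add s(a, b) f, Pi.add_apply, mul_add]
  simp only [edgeHomotopy_apply, preDiff_apply, Finset.mul_sum, mul_smul_comm]

theorem edgeHomotopy_mem_bidegreePart {f : PreChain R V} (hf : f ∈ bidegreePart R V i j) (a b : V) :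
    edgeHomotopy a b f ∈ bidegreePart R V (i - 1) (j + 1) := by
  have h := contraction_mem_bidegreePart hf s(a, b)
  intro s
  refine ⟨fun h' => (h s).1 (right_ne_zero_of_mul h'), ?_⟩
  rw [edgeHomotopy_apply, add_mul]
  exact Submodule.add_mem _ (X_mul_mem_homogeneousPart (h s).2 a)
    (X_mul_mem_homogeneousPart (h s).2 b)

theorem edgeHomotopy_mem_nullChains {a b : V} (hab : G.Adj a b) {f : PreChain R V}
    (hf : f ∈ nullChains R G) : edgeHomotopy a b f ∈ nullChains R G := by
  intro s hs
  rw [edgeHomotopy_apply]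
  by_cases hmem : s(a, b) ∈ s
  · rw [contraction_of_mem hmem, mul_zero]
    exact Ideal.zero_mem _
  · rw [contraction_of_notMem hmem, mul_smul_comm]
    refine zsmul_mem (X_add_X_mul_mem_colourIdeal (hf _ ?_)) _
    rw [Finset.coe_insert]
    exact Set.insert_subset hab hs

/-- For edges `{a, l}` and `{l, b}` of a graph, a homotopy between multiplication by `X a - X b` and
zero. -/
def pathHomotopy (a l b : V) : PreChain R V →ₗ[R] PreChain R V :=
  edgeHomotopy a l - edgeHomotopy l b

theorem preDiff_pathHomotopy_add (a l b : V) (f : PreChain R V) :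
    preDiff (pathHomotopy a l b f) + pathHomotopy a l b (preDiff f) =
      fun s => (X a - X b) * f s := by
  funext s
  have h₁ := preDiff_edgeHomotopy_add a l f s
  have h₂ := preDiff_edgeHomotopy_add l b f s
  simp only [pathHomotopy, LinearMap.sub_apply, map_sub, Pi.add_apply, Pi.sub_apply]
  linear_combination h₁ - h₂

theorem pathHomotopy_mem_bidegreePart {f : PreChain R V} (hf : f ∈ bidegreePart R V i (j - 1))
    (a l b : V) : pathHomotopy a l b f ∈ bidegreePart R V (i - 1) j := by
  have := Submodule.sub_mem _ (edgeHomotopy_mem_bidegreePart hf a l)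
    (edgeHomotopy_mem_bidegreePart hf l b)
  rwa [sub_add_cancel] at this

theorem pathHomotopy_mem_nullChains {a l b : V} (hal : G.Adj a l) (hlb : G.Adj l b)
    {f : PreChain R V} (hf : f ∈ nullChains R G) : pathHomotopy a l b f ∈ nullChains R G :=
  Submodule.sub_mem _ (edgeHomotopy_mem_nullChains hal hf) (edgeHomotopy_mem_nullChains hlb hf)

end Homotopy

section Recursion

variable {R : Type*} [CommRing R] {r : ℕ} {i j : ℤ} {l : Fin r → Fin (r + 1)}

/-- The map `starDiff k`, corrected by a homotopy along the path through `l k` so as to anticommute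
with the differential modulo the families that represent zero. -/
def starChainMap (l : Fin r → Fin (r + 1)) (k : Fin r) :
    PreChain R (Fin (r + 1 + 1)) →ₗ[R] PreChain R (Fin (r + 1)) :=
  starDiff k - pathHomotopy k.succ (l k) 0 ∘ₗ linearPart

theorem starChainMap_apply (k : Fin r) (f : PreChain R (Fin (r + 1 + 1))) :
    starChainMap l k f = starDiff k f - pathHomotopy k.succ (l k) 0 (linearPart f) := rfl

theorem starChainMap_mem_bidegreePart {f : PreChain R (Fin (r + 1 + 1))}
    (hf : f ∈ bidegreePart R _ i j) (k : Fin r) :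
    starChainMap l k f ∈ bidegreePart R _ (i - 1) j :=
  Submodule.sub_mem _ (starDiff_mem_bidegreePart hf k)
    (pathHomotopy_mem_bidegreePart (linearPart_mem_bidegreePart hf) k.succ (l k) 0)

theorem starChainMap_mem_nullChains (hl : ∀ k, k.succ ≠ l k) (hl0 : ∀ k, l k ≠ 0)
    {f : PreChain R (Fin (r + 1 + 1))} (hf : f ∈ nullChains R (K (r + 1 + 1))) (k : Fin r) :
    starChainMap l k f ∈ nullChains R (K (r + 1)) :=
  Submodule.sub_mem _ (starDiff_mem_nullChains hf k)
    (pathHomotopy_mem_nullChains (hl k) (hl0 k) (linearPart_mem_nullChains hf))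

theorem starChainMap_preDiff (k : Fin r) (f : PreChain R (Fin (r + 1 + 1))) :
    starChainMap l k (preDiff f) + preDiff (starChainMap l k f) ∈ nullChains R (K (r + 1)) := by
  have h := starDiff_preDiff k f
  rw [← preDiff_pathHomotopy_add k.succ (l k) 0 (linearPart f)] at h
  rw [starChainMap_apply, starChainMap_apply, linearPart_preDiff, map_sub]
  convert h using 1
  abel

theorem starDiff_mem_of_starChainMap_mem (hl : ∀ k, k.succ ≠ l k) (hl0 : ∀ k, l k ≠ 0)
    {f : PreChain R (Fin (r + 1 + 1))} (hlin : linearPart f ∈ nullChains R (K (r + 1))) {k : Fin r}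
    (hk : starChainMap l k f ∈ nullChains R (K (r + 1))) :
    starDiff k f ∈ nullChains R (K (r + 1)) := by
  have := Submodule.add_mem _ hk (pathHomotopy_mem_nullChains (hl k) (hl0 k) hlin)
  rwa [starChainMap_apply, sub_add_cancel] at this

theorem exists_linearPart_starChainMap {a : PreChain R (Fin (r + 1))}
    {c : Fin r → PreChain R (Fin (r + 1))} (ha : a ∈ bidegreePart R _ i (j - 1))
    (hc : ∀ k, c k ∈ bidegreePart R _ (i - 1) j) :
    ∃ f ∈ bidegreePart R (Fin (r + 1 + 1)) i j, linearPart f = a ∧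
      ∀ k, starChainMap l k f = c k := by
  obtain ⟨f, hf, hfa, hfc⟩ := exists_linearPart_starDiff ha fun k =>
    Submodule.add_mem _ (hc k) (pathHomotopy_mem_bidegreePart ha k.succ (l k) 0)
  exact ⟨f, hf, hfa, fun k => by rw [starChainMap_apply, hfc, hfa, add_sub_cancel_right]⟩

theorem isQuasiIsoFamily_linearPart_starChainMap (hl : ∀ k, k.succ ≠ l k) (hl0 : ∀ k, l k ≠ 0)
    (j : ℤ) :
    (model R (K (r + 1 + 1)) j).IsQuasiIsoFamily
      (fun k : Option (Fin r) => model R (K (r + 1)) (k.elim (j - 1) fun _ => j))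
      (fun k => k.elim 0 fun _ => 1) (fun k => k.elim 1 fun _ => -1)
      (fun k => k.elim linearPart (starChainMap l)) where
  map_mem_part k hf := by
    rcases k with _ | k
    · simpa [model] using linearPart_mem_bidegreePart hf
    · exact starChainMap_mem_bidegreePart hf k
  map_mem_null k hf := by
    rcases k with _ | k
    · exact linearPart_mem_nullChains hf
    · exact starChainMap_mem_nullChains hl hl0 hf k
  map_d k f := by
    rcases k with _ | k
    · simp [linearPart_preDiff]
    · simpa using starChainMap_preDiff k f
  exists_lift i y hy := by
    obtain ⟨f, hf, hlin, hstar⟩ := exists_linearPart_starChainMap (l := l)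
      (by simpa [model] using hy none) fun k => hy (some k)
    exact ⟨f, hf, Option.forall.2 ⟨hlin, hstar⟩⟩
  acyclic {i f} hf hφ := by
    have hlin := hφ none
    obtain ⟨y, hy, hy₁, hy₂, hfy⟩ := exists_preDiff_of_parts hf.1 hf.2 hlin fun k =>
      starDiff_mem_of_starChainMap_mem hl hl0 hlin (hφ (some k))
    refine ⟨y, hy, Option.forall.2 ⟨?_, fun k => ?_⟩, hfy⟩
    · simp [hy₁]
    · simp [starChainMap_apply, hy₁, hy₂]

theorem nonempty_cohomology_model_K_equiv (hr : 2 ≤ r) (i j : ℤ) :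
    Nonempty ((model R (K (r + 1 + 1)) j).Cohomology i ≃ₗ[R]
      (Fin r → (model R (K (r + 1)) j).Cohomology (i - 1)) ×
        (model R (K (r + 1)) (j - 1)).Cohomology i) := by
  have hex (k : Fin r) : ∃ l : Fin (r + 1), k.succ ≠ l ∧ l ≠ 0 := by
    have : Nontrivial (Fin r) := Fin.nontrivial_iff_two_le.2 hr
    obtain ⟨l, hl⟩ := exists_ne k
    exact ⟨l.succ, fun h => hl (Fin.succ_injective _ h).symm, Fin.succ_ne_zero l⟩
  choose l hl hl0 using hex
  have e := ((isQuasiIsoFamily_linearPart_starChainMap (R := R) hl hl0 j).cohomologyEquiv i).trans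
    ((LinearEquiv.piOptionEquivProd R).trans (LinearEquiv.prodComm R _ _))
  rw [show (i - Option.elim (none : Option (Fin r)) 0 fun _ => 1) = i from sub_zero i] at e
  exact ⟨e⟩

end Recursion

/-! ### Vanishing in high degrees -/

section Vanishing

variable {R : Type*} [CommRing R] {r : ℕ} {i j : ℤ} {f : PreChain R (Fin (r + 1 + 1))}

theorem linearPart_mem_cocycles (hf : f ∈ (model R (K (r + 1 + 1)) j).cocycles i) :
    linearPart f ∈ (model R (K (r + 1)) (j - 1)).cocycles i := by
  refine ⟨linearPart_mem_bidegreePart hf.1, ?_⟩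
  have h := linearPart_mem_nullChains hf.2
  rwa [model_d, linearPart_preDiff] at h

theorem starDiff_mem_cocycles (hf : f ∈ (model R (K (r + 1 + 1)) j).cocycles i)
    (hlin : linearPart f ∈ nullChains R (K (r + 1))) (k : Fin r) :
    starDiff k f ∈ (model R (K (r + 1)) j).cocycles (i - 1) := by
  refine ⟨starDiff_mem_bidegreePart hf.1 k, ?_⟩
  have hmul : (fun s => (X k.succ - X 0) * linearPart f s) ∈ nullChains R (K (r + 1)) :=
    fun s hs => Ideal.mul_mem_left _ _ (hlin s hs)
  have h := sub_mem (starDiff_preDiff k f) (starDiff_mem_nullChains hf.2 k)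
  rw [model_d, sub_sub_cancel_left, neg_sub] at h
  simpa using add_mem h hmul

theorem exists_linearPart_sub_preDiff_mem
    (hlin : linearPart f ∈ (model R (K (r + 1)) (j - 1)).coboundaries i) :
    ∃ g ∈ bidegreePart R (Fin (r + 1 + 1)) (i - 1) j,
      linearPart (f - preDiff g) ∈ nullChains R (K (r + 1)) := by
  obtain ⟨a, ha, haf⟩ := PresentedComplex.mem_coboundaries.1 hlin
  obtain ⟨g, hg, hga, -⟩ := exists_linearPart_starDiff (c := 0) ha fun _ => zero_mem _
  exact ⟨g, hg, by rwa [map_sub, linearPart_preDiff, hga]⟩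

theorem mem_coboundaries_of_starDiff_mem (hf : f ∈ (model R (K (r + 1 + 1)) j).cocycles i)
    (hlin : linearPart f ∈ nullChains R (K (r + 1)))
    (hstar : ∀ k, starDiff k f ∈ (model R (K (r + 1)) j).coboundaries (i - 1)) :
    f ∈ (model R (K (r + 1 + 1)) j).coboundaries i := by
  choose c hc hcf using fun k => PresentedComplex.mem_coboundaries.1 (hstar k)
  obtain ⟨g, hg, hg₀, hgc⟩ := exists_linearPart_starDiff (a := 0) (c := -c) (i := i - 1) (j := j)
    (zero_mem _) fun k => neg_mem (hc k)
  have hfg := PresentedComplex.sub_d_mem_cocycles hf hg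
  have hlin' : linearPart (f - preDiff g) ∈ nullChains R (K (r + 1)) := by
    rwa [map_sub, linearPart_preDiff, hg₀, map_zero, sub_zero]
  have hstar' (k : Fin r) : starDiff k (f - preDiff g) ∈ nullChains R (K (r + 1)) := by
    have h := starDiff_preDiff k g
    simp only [hg₀, hgc, Pi.neg_apply, Pi.zero_apply, mul_zero, map_neg, sub_neg_eq_add] at h
    have h' := sub_mem (hcf k) h
    rwa [model_d, sub_sub_sub_comm, ← Pi.zero_def, zero_add, sub_self, sub_zero,
      ← map_sub] at h'
  obtain ⟨y, hy, -, -, hfy⟩ := exists_preDiff_of_parts hfg.1 hfg.2 hlin' hstar'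
  exact PresentedComplex.mem_coboundaries.2 ⟨g + y, add_mem hg hy, by rwa [map_add, ← sub_sub]⟩

theorem cocycles_K_succ_le_coboundaries
    (hlin : ∀ j, (model R (K (r + 1)) j).cocycles i ≤ (model R (K (r + 1)) j).coboundaries i)
    (hstar : 0 < r → ∀ j, (model R (K (r + 1)) j).cocycles (i - 1) ≤
      (model R (K (r + 1)) j).coboundaries (i - 1)) (j : ℤ) :
    (model R (K (r + 1 + 1)) j).cocycles i ≤ (model R (K (r + 1 + 1)) j).coboundaries i := by
  intro f hf
  obtain ⟨g, hg, hfg⟩ := exists_linearPart_sub_preDiff_mem (hlin _ (linearPart_mem_cocycles hf))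
  have hf' := PresentedComplex.sub_d_mem_cocycles hf hg
  obtain ⟨y, hy, hfy⟩ := PresentedComplex.mem_coboundaries.1 <|
    mem_coboundaries_of_starDiff_mem hf' hfg fun k =>
      hstar k.pos _ (starDiff_mem_cocycles hf' hfg k)
  exact PresentedComplex.mem_coboundaries.2 ⟨g + y, add_mem hg hy, by rwa [map_add, ← sub_sub]⟩

theorem cocycles_K_one_le_coboundaries (hi : 0 < i) (j : ℤ) :
    (model R (K 1) j).cocycles i ≤ (model R (K 1) j).coboundaries i := by
  intro f hf
  refine Submodule.mem_sup_right fun s hs => ?_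
  obtain rfl : s = ∅ := by
    refine Finset.eq_empty_of_forall_notMem fun e he => subset_edgeSet_K.1 hs e he ?_
    induction e with | h a b => exact Subsingleton.elim a b
  by_cases h : f ∅ = 0
  · rw [h]
    exact Ideal.zero_mem _
  · exact absurd ((hf.1 ∅).1 h) hi.ne

theorem cocycles_K_le_coboundaries (r : ℕ) :
    ∀ i : ℤ, r < i → ∀ j, (model R (K (r + 1 + 1)) j).cocycles i ≤
      (model R (K (r + 1 + 1)) j).coboundaries i := by
  induction r with
  | zero =>
    exact fun i hi => cocycles_K_succ_le_coboundaries
      (cocycles_K_one_le_coboundaries (by simpa using hi)) fun h => absurd h (lt_irrefl 0)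
  | succ r ih =>
    intro i hi
    push_cast at hi
    exact cocycles_K_succ_le_coboundaries (ih i (by omega)) fun _ => ih (i - 1) (by omega)

end Vanishing

/-! ### Degree zero -/

section DegreeZero

theorem coeff_sqfreeExp_univ_mem {R V : Type*} [CommRing R] [Fintype V] {j : ℤ}
    {p : MvPolynomial V R} (hp : p ∈ homogeneousPart R V j) :
    coeff (sqfreeExp Finset.univ) p ∈
      (if j - Fintype.card V = 0 then ⊤ else ⊥ : Submodule R R) := by
  split_ifs with h
  · trivial
  · refine (Submodule.mem_bot R).2 (not_not.1 fun hne => h ?_)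
    rw [← mem_homogeneousPart.1 hp _ hne, degree_sqfreeExp, Finset.card_univ, sub_self]

variable {R : Type*} [CommRing R] {V : Type} [LinearOrder V] {j : ℤ}

theorem coeff_sqfreeExp_eq_zero_of_triangle (h2 : IsLeftRegular (2 : R)) {a b c : V}
    {p : MvPolynomial V R} (hab : p ∈ colourIdeal R {s(a, b)}) (hac : p ∈ colourIdeal R {s(a, c)})
    (hbc : p ∈ colourIdeal R {s(b, c)}) {Y : Finset V} (ha : a ∉ Y) :
    coeff (sqfreeExp Y) p = 0 := by
  rw [← insert_empty_eq] at hab hac hbc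
  have h := mem_colourIdeal_empty_iff.1 (two_mul_X_mul_mem_colourIdeal hab hac hbc) (insert a Y)
  rw [sqfreeExp, Finset.sum_insert ha, ← sqfreeExp, two_mul, coeff_add, ← two_mul,
    coeff_X_mul] at h
  exact h2.mul_left_eq_zero_iff.1 h

theorem coeff_sqfreeExp_eq_zero [Fintype V] (h2 : IsLeftRegular (2 : R)) (hV : 3 ≤ Fintype.card V)
    {p : MvPolynomial V R} (hp : ∀ a b, a ≠ b → p ∈ colourIdeal R {s(a, b)}) {Y : Finset V}
    (hY : Y ≠ Finset.univ) : coeff (sqfreeExp Y) p = 0 := by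
  obtain ⟨a, ha⟩ : ∃ a, a ∉ Y := by simpa [Finset.eq_univ_iff_forall] using hY
  have hcard : 1 < (Finset.univ.erase a).card := by
    rw [Finset.card_erase_of_mem (Finset.mem_univ a), Finset.card_univ]
    omega
  obtain ⟨b, hb, c, hc, hbc⟩ := Finset.one_lt_card.1 hcard
  exact coeff_sqfreeExp_eq_zero_of_triangle h2 (hp a b (Finset.ne_of_mem_erase hb).symm)
    (hp a c (Finset.ne_of_mem_erase hc).symm) (hp b c hbc) ha

theorem mem_colourIdeal_of_mem_cocycles_zero {G : SimpleGraph V} {f : PreChain R V}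
    (hf : f ∈ (model R G j).cocycles 0) {a b : V} (hab : G.Adj a b) :
    f ∅ ∈ colourIdeal R {s(a, b)} := by
  have h := hf.2 {s(a, b)} (by simpa using hab)
  rw [model_d, preDiff_apply, Finset.sum_singleton, Finset.erase_singleton] at h
  have h' := zsmul_mem h (edgeSign ∅ s(a, b))
  rwa [smul_smul, edgeSign_mul_self, one_smul] at h'

theorem mem_coboundaries_zero_iff {G : SimpleGraph V} {f : PreChain R V}
    (hf : f ∈ bidegreePart R V 0 j) :
    f ∈ (model R G j).coboundaries 0 ↔ f ∅ ∈ colourIdeal R ∅ := by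
  constructor
  · intro h
    obtain ⟨y, hy, hfy⟩ := PresentedComplex.mem_coboundaries.1 h
    rw [eq_zero_of_mem_bidegreePart_of_neg hy (by simp), map_zero, sub_zero] at hfy
    exact hfy ∅ (by simp)
  · refine fun h => Submodule.mem_sup_right fun s _ => ?_
    by_cases hs : s = ∅
    · rwa [hs]
    · have h0 : f s = 0 := by
        by_contra hne
        exact hs (by simpa using (hf s).1 hne)
      rw [h0]
      exact Ideal.zero_mem _

variable [Fintype V]

theorem single_prod_X_mem_cocycles (G : SimpleGraph V) :
    (Pi.single ∅ (∏ v, X v) : PreChain R V) ∈ (model R G (Fintype.card V)).cocycles 0 := by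
  refine ⟨single_mem_bidegreePart (prod_X_mem_homogeneousPart id Finset.univ) ∅, ?_⟩
  rw [SetLike.mem_coe, Submodule.mem_comap, model_d, preDiff_single]
  refine Submodule.sum_mem _ fun e _ => ?_
  rw [if_neg (Finset.notMem_empty e)]
  refine zsmul_mem (single_mem_nullChains fun he => ?_) _
  induction e with | h a b =>
  have hab : G.Adj a b := by simpa using he
  exact prod_X_mem_colourIdeal_of_mem hab.ne (by simp) (Finset.mem_univ a) (Finset.mem_univ b)

variable (R V) in
/-- The coefficient at the product of all vertex variables of a cocycle of degree zero. -/
def topCoeff (G : SimpleGraph V) (j : ℤ) : (model R G j).cocycles 0 →ₗ[R]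
    (if j - Fintype.card V = 0 then ⊤ else ⊥ : Submodule R R) :=
  (lcoeff R (sqfreeExp Finset.univ) ∘ₗ LinearMap.proj ∅ ∘ₗ Submodule.subtype _).codRestrict _
    fun f => coeff_sqfreeExp_univ_mem (f.2.1 ∅).2

theorem topCoeff_surjective (G : SimpleGraph V) (j : ℤ) :
    Function.Surjective (topCoeff R V G j) := by
  rintro ⟨c, hc⟩
  by_cases h : j - Fintype.card V = 0
  · obtain rfl := sub_eq_zero.1 h
    refine ⟨c • ⟨_, single_prod_X_mem_cocycles G⟩, Subtype.ext ?_⟩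
    change coeff _ ((c • (Pi.single ∅ (∏ v, X v) : PreChain R V)) ∅) = c
    rw [Pi.smul_apply, Pi.single_eq_same, ← monomial_sqfreeExp, coeff_smul, coeff_monomial,
      if_pos rfl, smul_eq_mul, mul_one]
  · rw [if_neg h, Submodule.mem_bot] at hc
    exact ⟨0, Subtype.ext (by rw [map_zero]; exact hc.symm)⟩

theorem topCoeff_eq_zero_iff (h2 : IsLeftRegular (2 : R)) (hV : 3 ≤ Fintype.card V)
    (f : (model R (⊤ : SimpleGraph V) j).cocycles 0) :
    topCoeff R V ⊤ j f = 0 ↔ f.1 ∈ (model R (⊤ : SimpleGraph V) j).coboundaries 0 := by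
  rw [mem_coboundaries_zero_iff f.2.1, mem_colourIdeal_empty_iff, Subtype.ext_iff]
  refine ⟨fun h Y => ?_, fun h => h _⟩
  obtain rfl | hY := eq_or_ne Y Finset.univ
  · exact h
  · exact coeff_sqfreeExp_eq_zero h2 hV
      (fun _ _ hab => mem_colourIdeal_of_mem_cocycles_zero f.2 hab) hY

/-- The cohomology of the polynomial model of a complete graph in degree zero. -/
def cohomologyZeroEquiv (h2 : IsLeftRegular (2 : R)) (hV : 3 ≤ Fintype.card V) (j : ℤ) :
    (model R (⊤ : SimpleGraph V) j).Cohomology 0 ≃ₗ[R]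
      (if j - Fintype.card V = 0 then ⊤ else ⊥ : Submodule R R) :=
  subquotientEquiv _ _ _ (topCoeff_surjective ⊤ j) (topCoeff_eq_zero_iff h2 hV)

end DegreeZero

theorem H_top_zero {V : Type} [LinearOrder V] [Fintype V] (hV : 3 ≤ Fintype.card V) :
    (H (⊤ : SimpleGraph V) 0).Isomorphic (GrMod.int.shift (Fintype.card V)) :=
  ⟨fun j => (homologyEquivModel ⊤ 0 j).trans
    (cohomologyZeroEquiv (IsRegular.of_ne_zero two_ne_zero).left hV j)⟩

theorem H_K_add_two_succ {r : ℕ} (hr : 2 ≤ r) (i : ℕ) :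
    (H (K (r + 1 + 1)) (i + 1)).Isomorphic
      (((H (K (r + 1)) i).power r).sum ((H (K (r + 1)) (i + 1)).shift 1)) := by
  refine ⟨fun j => ?_⟩
  have h := nonempty_cohomology_model_K_equiv (R := ℤ) hr ((i + 1 : ℕ) : ℤ) j
  rw [show ((i + 1 : ℕ) : ℤ) - 1 = i by simp] at h
  exact (homologyEquivModel _ (i + 1) j).trans (h.some.trans (LinearEquiv.prodCongr
    (LinearEquiv.piCongrRight fun _ => (homologyEquivModel (K (r + 1)) i j).symm)
    (homologyEquivModel (K (r + 1)) (i + 1) (j - 1)).symm))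

theorem H_K_add_two_of_lt {r i : ℕ} (hi : r < i) :
    (H (K (r + 1 + 1)) i).Isomorphic GrMod.zero := by
  refine ⟨fun j => (homologyEquivModel _ i j).trans
    (subquotientEquiv _ _ 0 (fun _ => ⟨0, rfl⟩) fun z => ?_)⟩
  have hz := cocycles_K_le_coboundaries r i (by exact_mod_cast hi) j z.2
  exact ⟨fun _ => hz, fun _ => rfl⟩

end ChromaticHomology

end

open ChromaticHomology in
theorem mainTheorem2 (n : ℕ) (hn : 4 ≤ n) :
    (H (K n) 0).Isomorphic (GrMod.int.shift n) ∧
    (∀ i : ℕ, 1 ≤ i → i ≤ n - 2 →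
      (H (K n) i).Isomorphic
        (((H (K (n - 1)) (i - 1)).power (n - 2)).sum ((H (K (n - 1)) i).shift 1))) ∧
    (∀ i : ℕ, n - 1 ≤ i → (H (K n) i).Isomorphic GrMod.zero) := by
  obtain ⟨r, rfl⟩ : ∃ r, n = r + 1 + 1 := ⟨n - 2, by omega⟩
  refine ⟨?_, fun i hi _ => ?_, fun i hi => H_K_add_two_of_lt (by omega)⟩
  · have hcard : Fintype.card (Fin (r + 1 + 1)) = r + 1 + 1 := Fintype.card_fin _
    have h := H_top_zero (V := Fin (r + 1 + 1)) (by omega)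
    rwa [hcard] at h
  · obtain ⟨i, rfl⟩ : ∃ i', i = i' + 1 := ⟨i - 1, by omega⟩
    exact H_K_add_two_succ (by omega) i
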